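/- For $\mathrm{Re}(s_1),\mathrm{Re}(s_2),\mathrm{Re}(s_3)>1$ let $$\zeta_{\mathfrak S}(s_1,s_2,s_3)=\sum_{n_1,n_2,n_3\ge 1}\frac{1}{(n_1+n_2)^{s_1}(n_2+n_3)^{s_2}(n_3+n_1)^{s_3}},$$ which converges absolutely. This function has a continuation to a meromorphic function on $\mathbb C^3$ (locally a quotient of two holomorphic functions, with removable singularities removed), again denoted $\zeta_{\mathfrak S}$, and $$\lim_{(s_1,s_2,s_3)\to(1,1,1)}(s_1+s_2+s_3-3)\,\zeta_{\mathfrak S}(s_1,s_2,s_3)=\frac{\pi^2}{4},$$ where the limit is taken over points $(s_1,s_2,s_3)\in\mathbb C^3$ with $s_1+s_2+s_3\neq 3$. -/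

import Mathlib

open Filter Topology

/-- `F` is represented near `p` by the quotient `P / Q` of two holomorphic functions, where `Q`
does not vanish identically near `p`. Nothing is said about the values of `F` at zeros of `Q`. -/
def IsLocalQuotient {n : ℕ} (F P Q : (Fin n → ℂ) → ℂ) (p : Fin n → ℂ) : Prop :=
  AnalyticAt ℂ P p ∧ AnalyticAt ℂ Q p ∧ ¬ (∀ᶠ z in 𝓝 p, Q z = 0) ∧
    ∀ᶠ z in 𝓝 p, Q z ≠ 0 → F z = P z / Q z

/-- `F` is a meromorphic function on `ℂⁿ`: it is locally a quotient of holomorphic functions, and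
at every point near which such a quotient extends to a holomorphic function `G`, it agrees
with `G` (removable singularities are removed, so `F` has the largest possible domain of
holomorphy). At the remaining points the value of `F` is irrelevant. -/
structure IsMeromorphicFunction {n : ℕ} (F : (Fin n → ℂ) → ℂ) : Prop where
  exists_quotient : ∀ p, ∃ P Q : (Fin n → ℂ) → ℂ, IsLocalQuotient F P Q p
  removable : ∀ (p : Fin n → ℂ) (P Q G : (Fin n → ℂ) → ℂ), IsLocalQuotient F P Q p →
    AnalyticAt ℂ G p → (∀ᶠ z in 𝓝 p, P z = G z * Q z) → ∀ᶠ z in 𝓝 p, F z = G z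

/-- The term of the symmetric zeta series at `(n₁, n₂, n₃)`. -/
noncomputable def symZetaTerm (s : Fin 3 → ℂ) (n : ℕ+ × ℕ+ × ℕ+) : ℂ :=
  1 / (((n.1 : ℂ) + (n.2.1 : ℂ)) ^ s 0 * ((n.2.1 : ℂ) + (n.2.2 : ℂ)) ^ s 1 *
    ((n.2.2 : ℂ) + (n.1 : ℂ)) ^ s 2)

/-- `F` is the symmetric zeta function, viewed as a meromorphic function on `ℂ³`: it is
meromorphic, and it is the (unconditional) sum of the symmetric zeta series where all three
variables have real part larger than `1`. -/
structure IsSymmetricZeta (F : (Fin 3 → ℂ) → ℂ) : Prop where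
  meromorphic : IsMeromorphicFunction F
  hasSum : ∀ s : Fin 3 → ℂ, (∀ i, 1 < (s i).re) → HasSum (symZetaTerm s) (F s)

section

open Complex Metric MeasureTheory

theorem torusMap_mem_closedBall {n : ℕ} (c : Fin n → ℂ) {R : ℝ} (hR : 0 < R) (θ : Fin n → ℝ) :
    torusMap c (fun _ => R) θ ∈ closedBall c R := by
  rw [closedBall_pi _ hR.le]
  intro i _
  simp [torusMap, Complex.norm_exp, abs_of_pos hR]

theorem torusMap_sub_ne_zero {n : ℕ} {c w : Fin n → ℂ} {R : ℝ} (hR : 0 < R) (hw : w ∈ ball c R)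
    (θ : Fin n → ℝ) (i : Fin n) : torusMap c (fun _ => R) θ i - w i ≠ 0 := by
  intro h
  rw [ball_pi _ hR] at hw
  have h1 := hw i (Set.mem_univ i)
  rw [← sub_eq_zero.1 h] at h1
  simp [torusMap, Complex.norm_exp, abs_of_pos hR] at h1

theorem continuous_comp_torusMap {n : ℕ} {f : (Fin n → ℂ) → ℂ} {c : Fin n → ℂ} {R : ℝ}
    (hR : 0 < R) (hf : ContinuousOn f (closedBall c R)) :
    Continuous fun θ => f (torusMap c (fun _ => R) θ) := by
  refine hf.comp_continuous ?_ (torusMap_mem_closedBall c hR)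
  unfold torusMap
  fun_prop

theorem torusIntegrable_cauchy {n : ℕ} {f : (Fin n → ℂ) → ℂ} {c w : Fin n → ℂ} {R : ℝ}
    (hR : 0 < R) (hf : ContinuousOn f (closedBall c R)) (hw : w ∈ ball c R) :
    TorusIntegrable (fun z => (∏ i, (z i - w i))⁻¹ * f z) c fun _ => R := by
  refine Continuous.integrableOn_Icc (Continuous.mul (Continuous.inv₀ ?_ ?_)
    (continuous_comp_torusMap hR hf))
  · unfold torusMap
    fun_prop
  · intro θ
    exact Finset.prod_ne_zero_iff.2 fun i _ => torusMap_sub_ne_zero hR hw θ i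

theorem differentiable_cons_right {n : ℕ} (x : ℂ) :
    Differentiable ℂ fun y : Fin n → ℂ => (Fin.cons x y : Fin (n + 1) → ℂ) := by
  rw [differentiable_pi]
  intro i
  refine Fin.cases ?_ (fun j => ?_) i
  · simp
  · simpa using differentiable_apply (𝕜 := ℂ) j

theorem differentiable_cons_left {n : ℕ} (y : Fin n → ℂ) :
    Differentiable ℂ fun x : ℂ => (Fin.cons x y : Fin (n + 1) → ℂ) := by
  rw [differentiable_pi]
  intro i
  refine Fin.cases ?_ (fun j => ?_) i
  · simp
  · simp

theorem cons_mem_closedBall {n : ℕ} {c : Fin (n + 1) → ℂ} {R : ℝ} (hR : 0 < R) {x : ℂ}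
    {y : Fin n → ℂ} (hx : x ∈ closedBall (c 0) R) (hy : y ∈ closedBall (c ∘ Fin.succ) R) :
    (Fin.cons x y : Fin (n + 1) → ℂ) ∈ closedBall c R := by
  rw [closedBall_pi _ hR.le] at hy ⊢
  intro i _
  refine Fin.cases ?_ (fun j => ?_) i
  · simpa using hx
  · simpa using hy j (Set.mem_univ j)

/-- Cauchy's integral formula on a polydisc. -/
theorem torusIntegral_cauchy {n : ℕ} {f : (Fin n → ℂ) → ℂ} {c w : Fin n → ℂ} {R : ℝ}
    (hR : 0 < R) (hf : DifferentiableOn ℂ f (closedBall c R)) (hw : w ∈ ball c R) :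
    torusIntegral (fun z => (∏ i, (z i - w i))⁻¹ * f z) c (fun _ => R) =
      (2 * Real.pi * I) ^ n * f w := by
  induction n with
  | zero => simp [Subsingleton.elim c w]
  | succ n ih =>
    have hw' := hw
    rw [ball_pi _ hR] at hw'
    have hw0 : w 0 ∈ ball (c 0) R := hw' 0 (Set.mem_univ _)
    have hws : w ∘ Fin.succ ∈ ball (c ∘ Fin.succ) R := by
      rw [ball_pi _ hR]
      exact fun i _ => hw' i.succ (Set.mem_univ _)
    rw [torusIntegral_succ (torusIntegrable_cauchy hR hf.continuousOn hw)]
    have h1 : ∀ x ∈ sphere (c 0) R,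
        torusIntegral (fun y : Fin n → ℂ => (∏ i, ((Fin.cons x y : Fin (n + 1) → ℂ) i - w i))⁻¹ *
          f (Fin.cons x y)) (c ∘ Fin.succ) ((fun _ => R) ∘ Fin.succ) =
        (2 * Real.pi * I) ^ n * ((x - w 0)⁻¹ • f (Fin.cons x (w ∘ Fin.succ))) := by
      intro x hx
      have h2 := ih (f := fun y => f (Fin.cons x y)) (c := c ∘ Fin.succ) (w := w ∘ Fin.succ)
        (hf.comp (differentiable_cons_right x).differentiableOn fun y hy =>
          cons_mem_closedBall hR (sphere_subset_closedBall hx) hy) hws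
      rw [smul_eq_mul, mul_left_comm, ← h2, ← torusIntegral_const_mul]
      congr 1
      ext y
      simp only [Fin.prod_univ_succ, Fin.cons_zero, Fin.cons_succ, Function.comp_apply, mul_inv]
      ring
    rw [circleIntegral.integral_congr hR.le h1, circleIntegral.integral_const_mul,
      DifferentiableOn.circleIntegral_sub_inv_smul _ hw0, smul_eq_mul]
    · have : (Fin.cons (w 0) (w ∘ Fin.succ) : Fin (n + 1) → ℂ) = w := Fin.cons_self_tail w
      rw [this]
      ring
    · exact hf.comp (differentiable_cons_left _).differentiableOn fun x hx =>
        cons_mem_closedBall hR hx (ball_subset_closedBall hws)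

/-- Osgood's lemma: complex differentiable functions on open subsets of `ℂⁿ` are analytic. -/
theorem DifferentiableOn.analyticOnNhd_pi {n : ℕ} {f : (Fin n → ℂ) → ℂ} {U : Set (Fin n → ℂ)}
    (hf : DifferentiableOn ℂ f U) (hU : IsOpen U) : AnalyticOnNhd ℂ f U := by
  intro p hp
  obtain ⟨R, hR, hRU⟩ := nhds_basis_closedBall.mem_iff.1 (hU.mem_nhds hp)
  have hd := hf.mono hRU
  let K : Set (Fin n → ℝ) := Set.Icc 0 (fun _ => 2 * Real.pi)
  have hcont := continuous_comp_torusMap hR hd.continuousOn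
  let F : C(K, ℂ) := (ContinuousMap.mk (fun θ : Fin n → ℝ =>
    (∏ i : Fin n, (R : ℂ) * Complex.exp ((θ i : ℂ) * Complex.I) * Complex.I) *
      f (torusMap p (fun _ => R) θ)) ((by fun_prop : Continuous fun θ : Fin n → ℝ =>
        ∏ i : Fin n, (R : ℂ) * Complex.exp ((θ i : ℂ) * Complex.I) * Complex.I).mul
          hcont)).comp ⟨Subtype.val, continuous_subtype_val⟩
  let Z : Fin n → C(K, ℂ) := fun i => (ContinuousMap.mk (fun θ : Fin n → ℝ =>
    torusMap p (fun _ => R) θ i) (by unfold torusMap; fun_prop)).comp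
      ⟨Subtype.val, continuous_subtype_val⟩
  let μ : Measure K := Measure.comap Subtype.val volume
  have hμ : IsFiniteMeasure μ := ⟨by
    rw [(MeasurableEmbedding.subtype_coe measurableSet_Icc).comap_apply]
    rw [Set.image_univ, Subtype.range_coe]
    exact measure_Icc_lt_top⟩
  have hint : ∀ a : C(K, ℂ), Integrable a μ := fun a =>
    a.continuous.integrable_of_hasCompactSupport (HasCompactSupport.of_compactSpace _)
  let Λ : C(K, ℂ) →L[ℂ] ℂ := LinearMap.mkContinuous
    { toFun := fun a => ∫ θ, a θ ∂μ
      map_add' := fun a b => integral_add (hint a) (hint b)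
      map_smul' := fun r a => integral_const_mul r _ }
    (μ.real Set.univ) (fun a => by
      refine le_of_le_of_eq ?_ (mul_comm _ _)
      exact norm_integral_le_of_norm_le_const (Eventually.of_forall a.norm_coe_le_norm))
  let A : (Fin n → ℂ) → C(K, ℂ) := fun z =>
    (∏ i, Ring.inverse (Z i - algebraMap ℂ C(K, ℂ) (z i))) * F
  have hunit : ∀ z ∈ ball p R, ∀ i, ∃ u : C(K, ℂ)ˣ, (u : C(K, ℂ)) = Z i - algebraMap ℂ _ (z i) ∧
      ∀ θ, ((u⁻¹ : C(K, ℂ)ˣ) : C(K, ℂ)) θ = (torusMap p (fun _ => R) θ.1 i - z i)⁻¹ := by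
    intro z hz i
    have hne := fun θ : K => torusMap_sub_ne_zero hR hz θ.1 i
    refine ⟨⟨Z i - algebraMap ℂ _ (z i), ⟨fun θ => (torusMap p (fun _ => R) θ.1 i - z i)⁻¹, ?_⟩,
      ?_, ?_⟩, rfl, fun θ => rfl⟩
    · exact Continuous.inv₀ (Z i - algebraMap ℂ _ (z i)).continuous hne
    · ext θ
      exact mul_inv_cancel₀ (hne θ)
    · ext θ
      exact inv_mul_cancel₀ (hne θ)
  have hA : AnalyticAt ℂ A p := by
    refine AnalyticAt.mul ?_ analyticAt_const
    refine Finset.analyticAt_fun_prod _ fun i _ => ?_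
    obtain ⟨u, hu, -⟩ := hunit p (mem_ball_self hR) i
    refine AnalyticAt.comp (g := Ring.inverse)
      (f := fun z : Fin n → ℂ => Z i - algebraMap ℂ C(K, ℂ) (z i)) ?_ ?_
    · rw [← hu]
      exact analyticAt_inverse u
    · refine analyticAt_const.sub ?_
      exact ((Algebra.linearMap ℂ C(K, ℂ)).mkContinuousOfExistsBound
        ⟨_, fun x => by rw [Algebra.linearMap_apply, norm_algebraMap, mul_comm]⟩ |>.comp
        (ContinuousLinearMap.proj (R := ℂ) i)).analyticAt p
  have hf_eq : ∀ᶠ z in 𝓝 p, ((2 * Real.pi * I) ^ n)⁻¹ * Λ (A z) = f z := by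
    filter_upwards [ball_mem_nhds p hR] with z hz
    have h1 := torusIntegral_cauchy hR hd hz
    have h2 : Λ (A z) = torusIntegral (fun ζ => (∏ i, (ζ i - z i))⁻¹ * f ζ) p (fun _ => R) := by
      rw [torusIntegral, ← integral_subtype_comap measurableSet_Icc]
      refine integral_congr_ae (Eventually.of_forall fun θ => ?_)
      have h3 : ∀ i, (Ring.inverse (Z i - algebraMap ℂ C(K, ℂ) (z i))) θ =
          (torusMap p (fun _ => R) θ.1 i - z i)⁻¹ := by
        intro i
        obtain ⟨u, hu, hu'⟩ := hunit z hz i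
        rw [← hu, Ring.inverse_unit, hu']
      simp only [A, F, ContinuousMap.mul_apply, ContinuousMap.prod_apply, h3,
        smul_eq_mul, Finset.prod_inv_distrib]
      exact mul_left_comm _ _ _
    rw [h2, h1, inv_mul_cancel_left₀]
    exact pow_ne_zero _ two_pi_I_ne_zero
  exact (analyticAt_const.mul ((Λ.analyticAt _).comp hA)).congr hf_eq

end

/-- Near a point where an analytic germ is nonzero, it is nonzero as a germ everywhere. -/
theorem AnalyticAt.eventually_not_eventually_zero {E : Type*} [NormedAddCommGroup E]
    [NormedSpace ℂ E] {Q : E → ℂ} {p : E} (hQ : AnalyticAt ℂ Q p)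
    (h0 : ¬ ∀ᶠ z in 𝓝 p, Q z = 0) : ∀ᶠ q in 𝓝 p, ¬ ∀ᶠ z in 𝓝 q, Q z = 0 := by
  obtain ⟨r, hr, h⟩ := hQ.exists_ball_analyticOnNhd
  filter_upwards [Metric.ball_mem_nhds p hr] with q hq hq0
  have := h.eqOn_of_preconnected_of_eventuallyEq analyticOnNhd_const
    (convex_ball p r).isPreconnected hq hq0
  exact h0 (eventually_of_mem (Metric.ball_mem_nhds p hr) this)

theorem ContinuousAt.eq_of_eventually_ne_imp_eq {E : Type*} [TopologicalSpace E]
    {Q f g : E → ℂ} {p : E} (hf : ContinuousAt f p) (hg : ContinuousAt g p)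
    (h0 : ¬ ∀ᶠ z in 𝓝 p, Q z = 0) (h : ∀ᶠ z in 𝓝 p, Q z ≠ 0 → f z = g z) : f p = g p := by
  by_contra hne
  refine h0 ?_
  filter_upwards [(hf.prodMk hg).eventually (isClosed_diagonal.isOpen_compl.mem_nhds
    (show (f p, g p) ∈ (Set.diagonal ℂ)ᶜ from hne)), h] with z hz hz'
  by_contra hQ
  exact hz (hz' hQ)

/-- Two analytic functions that agree off the zero set of a nonzero analytic germ agree. -/
theorem AnalyticAt.eventuallyEq_of_ne_imp_eq {E : Type*} [NormedAddCommGroup E] [NormedSpace ℂ E]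
    {Q f g : E → ℂ} {p : E} (hf : AnalyticAt ℂ f p) (hg : AnalyticAt ℂ g p)
    (hQ : AnalyticAt ℂ Q p) (h0 : ¬ ∀ᶠ z in 𝓝 p, Q z = 0)
    (h : ∀ᶠ z in 𝓝 p, Q z ≠ 0 → f z = g z) : ∀ᶠ z in 𝓝 p, f z = g z := by
  filter_upwards [hf.eventually_continuousAt, hg.eventually_continuousAt,
    hQ.eventually_not_eventually_zero h0, h.eventually_nhds] with z h1 h2 h3 h4
  exact h1.eq_of_eventually_ne_imp_eq h2 h3 h4

theorem AnalyticAt.not_eventually_mul_eq_zero {E : Type*} [NormedAddCommGroup E]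
    [NormedSpace ℂ E] {Q R : E → ℂ} {p : E} (hQ : AnalyticAt ℂ Q p) (hR : AnalyticAt ℂ R p)
    (hQ0 : ¬ ∀ᶠ z in 𝓝 p, Q z = 0) (hR0 : ¬ ∀ᶠ z in 𝓝 p, R z = 0) :
    ¬ ∀ᶠ z in 𝓝 p, Q z * R z = 0 := fun h =>
  hR0 (hR.eventuallyEq_of_ne_imp_eq analyticAt_const hQ hQ0
    (h.mono fun _ hz hne => (mul_eq_zero.1 hz).resolve_left hne))

/-- A compatible family of quotients of analytic functions on an exhaustion by open sets glues to
a meromorphic function. -/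
theorem exists_isMeromorphicFunction_of_exhaustion {n : ℕ} {Ω : ℕ → Set (Fin n → ℂ)}
    (hopen : ∀ k, IsOpen (Ω k)) (hcover : ∀ p, ∃ k, p ∈ Ω k)
    {P Q : ℕ → (Fin n → ℂ) → ℂ} (hP : ∀ k, AnalyticOnNhd ℂ (P k) (Ω k))
    (hQ : ∀ k, AnalyticOnNhd ℂ (Q k) (Ω k))
    (hQ0 : ∀ k, ∀ p ∈ Ω k, ¬ ∀ᶠ z in 𝓝 p, Q k z = 0)
    (hcomp : ∀ k l, ∀ z ∈ Ω k ∩ Ω l, P k z * Q l z = P l z * Q k z) :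
    ∃ F : (Fin n → ℂ) → ℂ, IsMeromorphicFunction F ∧
      ∀ k, ∀ z ∈ Ω k, Q k z ≠ 0 → F z = P k z / Q k z := by
  classical
  let R : (Fin n → ℂ) → ((Fin n → ℂ) → ℂ) → Prop := fun p G =>
    AnalyticAt ℂ G p ∧ ∃ k, p ∈ Ω k ∧ ∀ᶠ z in 𝓝 p, P k z = G z * Q k z
  have huniq : ∀ p G G', R p G → R p G' → G p = G' p := by
    rintro p G G' ⟨hG, k, hk, hGk⟩ ⟨hG', l, hl, hGl⟩
    refine (hG.eventuallyEq_of_ne_imp_eq hG' ((hQ k p hk).mul (hQ l p hl))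
      ((hQ k p hk).not_eventually_mul_eq_zero (hQ l p hl) (hQ0 k p hk) (hQ0 l p hl)) ?_).self_of_nhds
    filter_upwards [hGk, hGl, (hopen k).mem_nhds hk, (hopen l).mem_nhds hl] with z h1 h2 h3 h4 h5
    have h6 := hcomp k l z ⟨h3, h4⟩
    rw [h1, h2] at h6
    refine mul_right_cancel₀ h5 ?_
    simp only [Pi.mul_apply]
    linear_combination h6
  let F : (Fin n → ℂ) → ℂ := fun p => if h : ∃ G, R p G then h.choose p else 0
  have hF : ∀ p G, R p G → F p = G p := by
    intro p G hG
    have h : ∃ G, R p G := ⟨G, hG⟩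
    simp only [F, dif_pos h]
    exact huniq p _ _ h.choose_spec hG
  have hquot : ∀ k, ∀ z ∈ Ω k, Q k z ≠ 0 → F z = P k z / Q k z := by
    intro k z hz hne
    refine hF z (fun w => P k w / Q k w) ⟨(hP k z hz).div (hQ k z hz) hne, k, hz, ?_⟩
    filter_upwards [(hQ k z hz).continuousAt.eventually_ne hne] with w hw
    rw [div_mul_cancel₀ _ hw]
  refine ⟨F, ⟨fun p => ?_, fun p P' Q' G ⟨hP', hQ', hQ0', hF'⟩ hG hPG => ?_⟩, hquot⟩
  · obtain ⟨k, hk⟩ := hcover p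
    refine ⟨P k, Q k, hP k p hk, hQ k p hk, hQ0 k p hk, ?_⟩
    filter_upwards [(hopen k).mem_nhds hk] with z hz using hquot k z hz
  · obtain ⟨k, hk⟩ := hcover p
    have h1 : ∀ᶠ z in 𝓝 p, P k z = G z * Q k z := by
      refine (hP k p hk).eventuallyEq_of_ne_imp_eq (hG.mul (hQ k p hk))
        (hQ'.mul (hQ k p hk)) (hQ'.not_eventually_mul_eq_zero (hQ k p hk) hQ0' (hQ0 k p hk)) ?_
      filter_upwards [hF', hPG, (hopen k).mem_nhds hk] with z h2 h3 h4 h5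
      have h6 : Q' z ≠ 0 := left_ne_zero_of_mul h5
      have h7 : Q k z ≠ 0 := right_ne_zero_of_mul h5
      have h8 := h2 h6
      rw [hquot k z h4 h7, h3, mul_div_cancel_right₀ _ h6, div_eq_iff h7] at h8
      exact h8
    filter_upwards [h1.eventually_nhds, hG.eventually_analyticAt, (hopen k).mem_nhds hk]
      with z h2 h3 h4
    exact hF z G ⟨h3, k, h4, h2⟩

/-- A meromorphic function that is given by a quotient `P / Q` on an open set with `p` in its
closure is given by this quotient at all points near `p` where `Q` does not vanish. -/
theorem IsMeromorphicFunction.eventually_eq_div {n : ℕ} {F P Q : (Fin n → ℂ) → ℂ}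
    (hF : IsMeromorphicFunction F) {p : Fin n → ℂ} {U : Set (Fin n → ℂ)} (hU : IsOpen U)
    (hp : p ∈ closure U) (hP : AnalyticAt ℂ P p) (hQ : AnalyticAt ℂ Q p)
    (hU0 : ∀ z ∈ U, Q z ≠ 0 ∧ F z = P z / Q z) :
    ∀ᶠ z in 𝓝 p, Q z ≠ 0 → F z = P z / Q z := by
  obtain ⟨P', Q', hP', hQ', hQ0', hF'⟩ := hF.exists_quotient p
  obtain ⟨r, hr, hr'⟩ := Metric.eventually_nhds_iff_ball.1
    (hP.eventually_analyticAt.and (hQ.eventually_analyticAt.and (hP'.eventually_analyticAt.and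
      (hQ'.eventually_analyticAt.and ((hQ'.eventually_not_eventually_zero hQ0').and hF')))))
  obtain ⟨q, hqU, hq⟩ := Metric.mem_closure_iff.1 hp r hr
  have hqr : q ∈ Metric.ball p r := by rwa [Metric.mem_ball, dist_comm]
  have hq' := hr' q hqr
  have hloc : ∀ᶠ z in 𝓝 q, P' z * Q z = P z * Q' z := by
    refine (hq'.2.2.1.mul hq'.2.1).eventuallyEq_of_ne_imp_eq (hq'.1.mul hq'.2.2.2.1)
      hq'.2.2.2.1 hq'.2.2.2.2.1 ?_
    filter_upwards [hU.mem_nhds hqU, Metric.isOpen_ball.mem_nhds hqr] with z h1 h2 h3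
    have h4 := (hr' z h2).2.2.2.2.2 h3
    rw [(hU0 z h1).2, div_eq_div_iff (hU0 z h1).1 h3] at h4
    exact h4.symm
  have hball : Set.EqOn (fun z => P' z * Q z) (fun z => P z * Q' z) (Metric.ball p r) :=
    AnalyticOnNhd.eqOn_of_preconnected_of_eventuallyEq
      (fun z hz => (hr' z hz).2.2.1.mul (hr' z hz).2.1)
      (fun z hz => (hr' z hz).1.mul (hr' z hz).2.2.2.1)
      (convex_ball p r).isPreconnected hqr hloc
  filter_upwards [Metric.ball_mem_nhds p hr] with z hz hne
  obtain ⟨h1, h2, h3, h4, h5, -⟩ := hr' z hz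
  refine (hF.removable z P' Q' (fun w => P w / Q w) ⟨h3, h4, h5, ?_⟩ (h1.div h2 hne)
    ?_).self_of_nhds
  · filter_upwards [Metric.isOpen_ball.mem_nhds hz] with w hw using (hr' w hw).2.2.2.2.2
  · filter_upwards [Metric.isOpen_ball.mem_nhds hz, h2.continuousAt.eventually_ne hne] with w hw hw'
    rw [div_mul_eq_mul_div, eq_div_iff hw']
    exact hball hw

section

open MeasureTheory

/-- The open positive octant in `ℝⁿ`. -/
def octant (n : ℕ) : Set (Fin n → ℝ) := Set.univ.pi fun _ => Set.Ioi 0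

theorem mem_octant {n : ℕ} {t : Fin n → ℝ} : t ∈ octant n ↔ ∀ i, 0 < t i := by
  simp [octant]

theorem measurableSet_octant (n : ℕ) : MeasurableSet (octant n) :=
  MeasurableSet.univ_pi fun _ => measurableSet_Ioi

theorem volume_restrict_octant (n : ℕ) :
    (volume : Measure (Fin n → ℝ)).restrict (octant n) =
      Measure.pi fun _ => volume.restrict (Set.Ioi 0) := by
  rw [octant, volume_pi, Measure.restrict_pi_pi]

/-- The kernel `∏ tᵢ ^ (sᵢ - 1)` of the multivariate Mellin transform. -/
noncomputable def mellinKernel {n : ℕ} (s : Fin n → ℂ) (t : Fin n → ℝ) : ℂ :=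
  ∏ i, (t i : ℂ) ^ (s i - 1)

/-- The multivariate Mellin transform. -/
noncomputable def mellinPi {n : ℕ} (F : (Fin n → ℝ) → ℂ) (s : Fin n → ℂ) : ℂ :=
  ∫ t in octant n, mellinKernel s t * F t

/-- Absolute convergence of the multivariate Mellin transform. -/
def MellinPiConvergent {n : ℕ} (F : (Fin n → ℝ) → ℂ) (s : Fin n → ℂ) : Prop :=
  IntegrableOn (fun t => mellinKernel s t * F t) (octant n)

theorem measurable_mellinKernel {n : ℕ} (s : Fin n → ℂ) : Measurable (mellinKernel s) := by
  unfold mellinKernel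
  fun_prop

theorem norm_mellinKernel {n : ℕ} (s : Fin n → ℂ) {t : Fin n → ℝ} (ht : t ∈ octant n) :
    ‖mellinKernel s t‖ = ∏ i, t i ^ ((s i).re - 1) := by
  rw [mellinKernel, norm_prod]
  refine Finset.prod_congr rfl fun i _ => ?_
  rw [Complex.norm_cpow_eq_rpow_re_of_pos (mem_octant.1 ht i)]
  simp

theorem mellinKernel_eq_exp {n : ℕ} (s : Fin n → ℂ) {t : Fin n → ℝ} (ht : t ∈ octant n) :
    mellinKernel s t = Complex.exp (∑ i, (s i - 1) * (Real.log (t i) : ℂ)) := by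
  rw [mellinKernel, Complex.exp_sum]
  refine Finset.prod_congr rfl fun i _ => ?_
  have h := mem_octant.1 ht i
  rw [Complex.cpow_def_of_ne_zero (by exact_mod_cast h.ne'), Complex.ofReal_log h.le, mul_comm]

theorem integrableOn_octant_prod {n : ℕ} {𝕜 : Type*} [RCLike 𝕜] {f : Fin n → ℝ → 𝕜}
    (hf : ∀ i, IntegrableOn (f i) (Set.Ioi 0)) :
    IntegrableOn (fun t : Fin n → ℝ => ∏ i, f i (t i)) (octant n) := by
  rw [IntegrableOn, volume_restrict_octant]
  exact Integrable.fintype_prod hf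

theorem integral_octant_prod {n : ℕ} {𝕜 : Type*} [RCLike 𝕜] (f : Fin n → ℝ → 𝕜) :
    ∫ t in octant n, ∏ i, f i (t i) = ∏ i, ∫ x in Set.Ioi 0, f i x := by
  rw [volume_restrict_octant]
  exact integral_fintype_prod_eq_prod f

section Scaling

variable {n : ℕ} {c : Fin n → ℝ}

theorem map_mul_volume_restrict_octant (hc : ∀ i, 0 < c i) :
    ((volume : Measure (Fin n → ℝ)).restrict (octant n)).map (fun t => c * t) =
      ENNReal.ofReal (∏ i, c i)⁻¹ • volume.restrict (octant n) := by
  have hdet : (Matrix.diagonal c).det ≠ 0 := by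
    rw [Matrix.det_diagonal]
    exact Finset.prod_ne_zero_iff.2 fun i _ => (hc i).ne'
  have h := Real.map_matrix_volume_pi_eq_smul_volume_pi hdet
  have h1 : (fun t : Fin n → ℝ => c * t) = Matrix.toLin' (Matrix.diagonal c) := by
    ext t i
    simp [Matrix.toLin'_apply, Matrix.mulVec_diagonal]
  have h2 : octant n = (fun t : Fin n → ℝ => c * t) ⁻¹' octant n := by
    ext t
    simp [mem_octant, hc]
  conv_lhs => rw [h2]
  rw [← Measure.restrict_map (by fun_prop) (measurableSet_octant n), h1, h, Measure.restrict_smul,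
    Matrix.det_diagonal, abs_of_pos (inv_pos.2 (Finset.prod_pos fun i _ => hc i))]

theorem measurableEmbedding_mul_left (hc : ∀ i, 0 < c i) :
    MeasurableEmbedding fun t : Fin n → ℝ => c * t :=
  (Homeomorph.piCongrRight fun i => Homeomorph.mulLeft₀ (c i) (hc i).ne').measurableEmbedding

theorem integral_octant_comp_mul {E : Type*} [NormedAddCommGroup E] [NormedSpace ℝ E]
    (hc : ∀ i, 0 < c i) (G : (Fin n → ℝ) → E) :
    ∫ t in octant n, G (c * t) = (∏ i, c i)⁻¹ • ∫ t in octant n, G t := by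
  have h := (measurableEmbedding_mul_left hc).integral_map (μ := volume.restrict (octant n)) G
  rw [← h, map_mul_volume_restrict_octant hc, integral_smul_measure, ENNReal.toReal_ofReal
    (inv_nonneg.2 (Finset.prod_nonneg fun i _ => (hc i).le))]

theorem integrableOn_octant_comp_mul (hc : ∀ i, 0 < c i) {G : (Fin n → ℝ) → ℂ}
    (hG : IntegrableOn G (octant n)) : IntegrableOn (fun t => G (c * t)) (octant n) := by
  refine ((measurableEmbedding_mul_left hc).integrable_map_iff).1 ?_
  rw [map_mul_volume_restrict_octant hc]
  exact Integrable.smul_measure hG ENNReal.ofReal_ne_top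

theorem mellinKernel_mul (hc : ∀ i, 0 < c i) (s : Fin n → ℂ) {t : Fin n → ℝ}
    (ht : t ∈ octant n) : mellinKernel s (c * t) = mellinKernel s c * mellinKernel s t := by
  rw [mellinKernel, mellinKernel, mellinKernel, ← Finset.prod_mul_distrib]
  refine Finset.prod_congr rfl fun i _ => ?_
  rw [Pi.mul_apply, Complex.ofReal_mul,
    Complex.mul_cpow_ofReal_nonneg (hc i).le (mem_octant.1 ht i).le]

theorem mellinKernel_ne_zero (hc : ∀ i, 0 < c i) (s : Fin n → ℂ) : mellinKernel s c ≠ 0 :=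
  Finset.prod_ne_zero_iff.2 fun i _ => by
    rw [Complex.cpow_ne_zero_iff]
    exact Or.inl (by exact_mod_cast (hc i).ne')

theorem MellinPiConvergent.comp_mul (hc : ∀ i, 0 < c i) {F : (Fin n → ℝ) → ℂ} {s : Fin n → ℂ}
    (h : MellinPiConvergent F s) : MellinPiConvergent (fun t => F (c * t)) s := by
  refine IntegrableOn.congr_fun
    ((integrableOn_octant_comp_mul hc h).const_mul (mellinKernel s c)⁻¹) (fun t ht => ?_)
    (measurableSet_octant n)
  simp only [mellinKernel_mul hc s ht]
  field_simp [mellinKernel_ne_zero hc s]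

theorem mellinPi_comp_mul (hc : ∀ i, 0 < c i) (F : (Fin n → ℝ) → ℂ) (s : Fin n → ℂ) :
    mellinPi (fun t => F (c * t)) s = (∏ i, (c i : ℂ) ^ (-s i)) * mellinPi F s := by
  have h1 : mellinPi (fun t => F (c * t)) s =
      (mellinKernel s c)⁻¹ * ∫ t in octant n, mellinKernel s (c * t) * F (c * t) := by
    rw [mellinPi, ← integral_const_mul]
    refine setIntegral_congr_fun (measurableSet_octant n) fun t ht => ?_
    simp only [mellinKernel_mul hc s ht]
    field_simp [mellinKernel_ne_zero hc s]
  rw [h1, integral_octant_comp_mul hc fun t => mellinKernel s t * F t, Complex.real_smul,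
    ← mul_assoc, mellinPi,
    mellinKernel, Complex.ofReal_inv, Complex.ofReal_prod, ← Finset.prod_inv_distrib,
    ← Finset.prod_inv_distrib, ← Finset.prod_mul_distrib]
  congr 1
  refine Finset.prod_congr rfl fun i _ => ?_
  have hci : (c i : ℂ) ≠ 0 := by exact_mod_cast (hc i).ne'
  rw [Complex.cpow_sub _ _ hci, Complex.cpow_one, Complex.cpow_neg]
  field_simp [hci]

end Scaling

/-- The action of a polynomial on functions, where the variable `Xᵢ` doubles the `i`-th
coordinate. -/
noncomputable def dilate {n : ℕ} (p : MvPolynomial (Fin n) ℂ) (F : (Fin n → ℝ) → ℂ)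
    (t : Fin n → ℝ) : ℂ :=
  ∑ m ∈ p.support, p.coeff m * F ((fun i => (2 : ℝ) ^ m i) * t)

theorem mellinPi_dilate {n : ℕ} (p : MvPolynomial (Fin n) ℂ) {F : (Fin n → ℝ) → ℂ}
    {s : Fin n → ℂ} (h : MellinPiConvergent F s) :
    mellinPi (dilate p F) s = MvPolynomial.eval (fun i => (2 : ℂ) ^ (-s i)) p * mellinPi F s := by
  have hc : ∀ m : Fin n →₀ ℕ, ∀ i, 0 < (2 : ℝ) ^ m i := fun m i => by positivity
  have h1 : mellinPi (dilate p F) s =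
      ∑ m ∈ p.support, p.coeff m * mellinPi (fun t => F ((fun i => (2 : ℝ) ^ m i) * t)) s := by
    simp only [mellinPi, dilate, Finset.mul_sum, ← integral_const_mul]
    rw [← integral_finsetSum]
    · refine integral_congr_ae (Eventually.of_forall fun t => ?_)
      exact Finset.sum_congr rfl fun m _ => by ring
    · intro m _
      exact (h.comp_mul (hc m)).const_mul _
  rw [h1, MvPolynomial.eval_eq', Finset.sum_mul]
  refine Finset.sum_congr rfl fun m _ => ?_
  rw [mellinPi_comp_mul (hc m), mul_assoc]
  congr 2
  refine Finset.prod_congr rfl fun i _ => ?_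
  rw [← Complex.cpow_nat_mul, Complex.ofReal_pow, Complex.ofReal_ofNat]
  exact_mod_cast (Complex.natCast_cpow_natCast_mul 2 (m i) (-s i)).symm

theorem rpow_le_add_rpow {x a b c : ℝ} (hx : 0 < x) (hab : a ≤ b) (hbc : b ≤ c) :
    x ^ b ≤ x ^ a + x ^ c := by
  rcases le_total x 1 with h | h
  · exact (Real.rpow_le_rpow_of_exponent_ge hx h hab).trans
      (le_add_of_nonneg_right (Real.rpow_nonneg hx.le _))
  · exact (Real.rpow_le_rpow_of_exponent_le h hbc).trans
      (le_add_of_nonneg_left (Real.rpow_nonneg hx.le _))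

theorem one_add_abs_log_le {x δ : ℝ} (hx : 0 < x) (hδ : 0 < δ) :
    1 + |Real.log x| ≤ (1 + 1 / δ) * (x ^ (-δ) + x ^ δ) := by
  have h1 := Real.log_le_rpow_div hx.le hδ
  have h2 := Real.log_le_rpow_div (inv_pos.2 hx).le hδ
  rw [Real.log_inv, Real.inv_rpow hx.le, ← Real.rpow_neg hx.le] at h2
  have h3 := rpow_le_add_rpow (b := 0) hx (neg_nonpos.2 hδ.le) hδ.le
  rw [Real.rpow_zero] at h3
  have h4 := Real.rpow_nonneg hx.le δ
  have h5 := Real.rpow_nonneg hx.le (-δ)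
  have h6 : |Real.log x| ≤ (x ^ (-δ) + x ^ δ) / δ := by
    rw [add_div, abs_le]
    have := div_nonneg h4 hδ.le
    have := div_nonneg h5 hδ.le
    constructor <;> linarith
  calc _ ≤ (x ^ (-δ) + x ^ δ) + (x ^ (-δ) + x ^ δ) / δ := add_le_add h3 h6
    _ = _ := by ring

theorem integrableOn_rpow_mul_pow_mul_exp {σ ε : ℝ} {K : ℕ} (hσ : -K < σ) (hε : 0 < ε) :
    IntegrableOn (fun x : ℝ => x ^ (σ - 1) * (x ^ K * Real.exp (-ε * x))) (Set.Ioi 0) := by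
  refine (integrableOn_rpow_mul_exp_neg_mul_rpow (p := 1) (s := σ - 1 + K) (by linarith) one_pos
    hε).congr_fun (fun x hx => ?_) measurableSet_Ioi
  simp only [Real.rpow_one]
  rw [Real.rpow_add hx, Real.rpow_natCast, mul_assoc]

theorem one_add_sum_le_prod_one_add {ι : Type*} (s : Finset ι) {f : ι → ℝ} (hf : ∀ i, 0 ≤ f i) :
    1 + ∑ i ∈ s, f i ≤ ∏ i ∈ s, (1 + f i) := by
  classical
  induction s using Finset.induction_on with
  | empty => simp
  | insert a s ha ih =>
    rw [Finset.sum_insert ha, Finset.prod_insert ha]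
    nlinarith [hf a, Finset.sum_nonneg fun i (_ : i ∈ s) => hf i]

theorem differentiableOn_mellinPi {n : ℕ} {F : (Fin n → ℝ) → ℂ} {C ε : ℝ} {K : ℕ}
    (hF : AEStronglyMeasurable F (volume.restrict (octant n))) (hε : 0 < ε)
    (hb : ∀ t ∈ octant n, ‖F t‖ ≤ C * ∏ i, (t i ^ K * Real.exp (-ε * t i))) :
    DifferentiableOn ℂ (mellinPi F) {s | ∀ i, -(K : ℝ) < (s i).re} := by
  intro s hs
  have hC : ∀ t ∈ octant n, 0 ≤ C * ∏ i, (t i ^ K * Real.exp (-ε * t i)) := fun t ht =>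
    (norm_nonneg _).trans (hb t ht)
  obtain ⟨δ, hδ, hδs⟩ : ∃ δ > 0, ∀ i, -(K : ℝ) < (s i).re - 2 * δ := by
    have h1 : ∀ i, ∀ᶠ δ in 𝓝[>] (0 : ℝ), -(K : ℝ) < (s i).re - 2 * δ := fun i => by
      have : Tendsto (fun δ : ℝ => (s i).re - 2 * δ) (𝓝[>] 0) (𝓝 ((s i).re - 2 * 0)) :=
        (Continuous.tendsto (by fun_prop) 0).mono_left nhdsWithin_le_nhds
      exact this.eventually_const_lt (by simpa using hs i)
    obtain ⟨δ, h2, h3⟩ := ((eventually_all.2 h1).and self_mem_nhdsWithin).exists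
    exact ⟨δ, h3, h2⟩
  let L : (Fin n → ℝ) → (Fin n → ℂ) →L[ℂ] ℂ := fun t =>
    ∑ i, (Real.log (t i) : ℂ) • ContinuousLinearMap.proj (R := ℂ) i
  let F' : (Fin n → ℂ) → (Fin n → ℝ) → (Fin n → ℂ) →L[ℂ] ℂ := fun z t =>
    (mellinKernel z t * F t) • L t
  let w : Fin n → ℝ → ℝ := fun i x => (1 + 1 / δ) * (x ^ (-δ) + x ^ δ) *
    (x ^ ((s i).re - δ - 1) + x ^ ((s i).re + δ - 1)) * (x ^ K * Real.exp (-ε * x))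
  have hw : ∀ i, IntegrableOn (w i) (Set.Ioi 0) := by
    intro i
    have h1 : ∀ σ, -(K : ℝ) < σ → _ := fun σ hσ => integrableOn_rpow_mul_pow_mul_exp hσ hε
    have h2 := ((h1 ((s i).re - 2 * δ) (hδs i)).add (((h1 (s i).re (hs i)).const_mul 2).add
      (h1 ((s i).re + 2 * δ) (by linarith [hs i])))).const_mul (1 + 1 / δ)
    refine IntegrableOn.congr_fun h2 (fun x hx => ?_) measurableSet_Ioi
    have hx' : 0 < x := hx
    have e1 : x ^ ((s i).re - 2 * δ - 1) = x ^ (-δ) * x ^ ((s i).re - δ - 1) := by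
      rw [← Real.rpow_add hx']; ring_nf
    have e2 : x ^ ((s i).re - 1) = x ^ (-δ) * x ^ ((s i).re + δ - 1) := by
      rw [← Real.rpow_add hx']; ring_nf
    have e3 : x ^ ((s i).re - 1) = x ^ δ * x ^ ((s i).re - δ - 1) := by
      rw [← Real.rpow_add hx']; ring_nf
    have e4 : x ^ ((s i).re + 2 * δ - 1) = x ^ δ * x ^ ((s i).re + δ - 1) := by
      rw [← Real.rpow_add hx']; ring_nf
    simp only [w, Pi.add_apply, e1, e4]
    linear_combination (1 + 1 / δ) * (x ^ K * Real.exp (-ε * x)) * (e2 + e3)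
  have hker : ∀ z ∈ Metric.ball s δ, ∀ t ∈ octant n, ‖mellinKernel z t‖ ≤
      ∏ i, (t i ^ ((s i).re - δ - 1) + t i ^ ((s i).re + δ - 1)) := by
    intro z hz t ht
    rw [norm_mellinKernel z ht]
    refine Finset.prod_le_prod (fun i _ => Real.rpow_nonneg (mem_octant.1 ht i).le _) fun i _ => ?_
    have h1 : |(z i - s i).re| < δ := by
      rw [ball_pi _ hδ] at hz
      have := hz i (Set.mem_univ i)
      rw [Metric.mem_ball, dist_eq_norm] at this
      exact (Complex.abs_re_le_norm _).trans_lt this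
    rw [Complex.sub_re, abs_lt] at h1
    exact rpow_le_add_rpow (mem_octant.1 ht i) (by linarith) (by linarith)
  have hL : ∀ t, ‖L t‖ ≤ ∏ i, (1 + |Real.log (t i)|) := by
    intro t
    have h1 : ‖L t‖ ≤ ∑ i, |Real.log (t i)| := by
      refine (norm_sum_le _ _).trans (Finset.sum_le_sum fun i _ => ?_)
      rw [norm_smul, Complex.norm_real, Real.norm_eq_abs]
      refine mul_le_of_le_one_right (abs_nonneg _) ?_
      refine ContinuousLinearMap.opNorm_le_bound _ zero_le_one fun x => ?_
      rw [one_mul]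
      exact norm_le_pi_norm x i
    have h2 := one_add_sum_le_prod_one_add Finset.univ
      (f := fun i => |Real.log (t i)|) (fun i => abs_nonneg _)
    linarith
  have hmeas : ∀ z, AEStronglyMeasurable (fun t => mellinKernel z t * F t)
      (volume.restrict (octant n)) := fun z =>
    (measurable_mellinKernel z).aestronglyMeasurable.mul hF
  have hint : Integrable (fun t : Fin n → ℝ => C * ∏ i, w i (t i))
      (volume.restrict (octant n)) := (integrableOn_octant_prod hw).const_mul C
  have hlog : ∀ t ∈ octant n, ∏ i, (1 + |Real.log (t i)|) ≤
      ∏ i, (1 + 1 / δ) * (t i ^ (-δ) + t i ^ δ) := fun t ht =>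
    Finset.prod_le_prod (fun i _ => by positivity) fun i _ =>
      one_add_abs_log_le (mem_octant.1 ht i) hδ
  have hbound : ∀ z ∈ Metric.ball s δ, ∀ t ∈ octant n,
      ‖mellinKernel z t * F t‖ * ∏ i, (1 + |Real.log (t i)|) ≤ C * ∏ i, w i (t i) := by
    intro z hz t ht
    have hpos : ∀ i, 0 < t i := mem_octant.1 ht
    rw [norm_mul]
    refine (mul_le_mul (mul_le_mul (hker z hz t ht) (hb t ht) (norm_nonneg _)
      (Finset.prod_nonneg fun i _ => add_nonneg (Real.rpow_nonneg (hpos i).le _)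
        (Real.rpow_nonneg (hpos i).le _))) (hlog t ht)
      (Finset.prod_nonneg fun i _ => by positivity)
      (mul_nonneg (Finset.prod_nonneg fun i _ => add_nonneg (Real.rpow_nonneg (hpos i).le _)
        (Real.rpow_nonneg (hpos i).le _)) (hC t ht))).trans (le_of_eq ?_)
    simp only [w, Finset.prod_mul_distrib]
    ring
  have main := hasFDerivAt_integral_of_dominated_of_fderiv_le (𝕜 := ℂ)
    (F := fun z t => mellinKernel z t * F t) (F' := F') (x₀ := s)
    (bound := fun t => C * ∏ i, w i (t i)) (μ := volume.restrict (octant n))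
    (Metric.ball_mem_nhds s hδ) (Eventually.of_forall hmeas) ?_ ?_ ?_ hint ?_
  · exact main.differentiableAt.differentiableWithinAt
  · refine hint.mono' (hmeas s) ((ae_restrict_iff' (measurableSet_octant n)).2
      (Eventually.of_forall fun t ht => ?_))
    refine le_trans (le_mul_of_one_le_right (norm_nonneg _) ?_)
      (hbound s (Metric.mem_ball_self hδ) t ht)
    calc (1 : ℝ) = ∏ i : Fin n, 1 := by simp
      _ ≤ _ := Finset.prod_le_prod (fun _ _ => zero_le_one) fun i _ => by simp
  · refine (hmeas s).smul (Measurable.aestronglyMeasurable ?_)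
    refine Finset.measurable_fun_sum _ fun i _ => ?_
    exact Measurable.smul_const (Complex.measurable_ofReal.comp
      (Real.measurable_log.comp (measurable_pi_apply i))) _
  · refine (ae_restrict_iff' (measurableSet_octant n)).2 (Eventually.of_forall fun t ht z hz => ?_)
    rw [norm_smul]
    exact (mul_le_mul_of_nonneg_left (hL t) (norm_nonneg _)).trans (hbound z hz t ht)
  · refine (ae_restrict_iff' (measurableSet_octant n)).2 (Eventually.of_forall fun t ht z _ => ?_)
    have h1 : HasFDerivAt (fun z : Fin n → ℂ => ∑ i, (z i - 1) * (Real.log (t i) : ℂ)) (L t) z := by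
      refine HasFDerivAt.fun_sum fun i _ => ?_
      exact ((hasFDerivAt_apply i z).sub_const 1).mul_const (Real.log (t i) : ℂ)
    have h2 := h1.cexp.mul_const (F t)
    have h3 : (fun z : Fin n → ℂ => mellinKernel z t * F t) =
        fun z => Complex.exp (∑ i, (z i - 1) * (Real.log (t i) : ℂ)) * F t :=
      funext fun z => by rw [mellinKernel_eq_exp z ht]
    rw [h3]
    refine h2.congr_fderiv ?_
    rw [smul_smul, ← mellinKernel_eq_exp z ht, mul_comm]

theorem analyticOnNhd_mellinPi {n : ℕ} {F : (Fin n → ℝ) → ℂ} {C ε : ℝ} {K : ℕ}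
    (hF : AEStronglyMeasurable F (volume.restrict (octant n))) (hε : 0 < ε)
    (hb : ∀ t ∈ octant n, ‖F t‖ ≤ C * ∏ i, (t i ^ K * Real.exp (-ε * t i))) :
    AnalyticOnNhd ℂ (mellinPi F) {s | ∀ i, -(K : ℝ) < (s i).re} := by
  refine (differentiableOn_mellinPi hF hε hb).analyticOnNhd_pi ?_
  simp only [Set.ofPred_forall]
  exact isOpen_iInter_of_finite fun i =>
    isOpen_lt continuous_const (Complex.continuous_re.comp (continuous_apply i))

end

section

open MeasureTheory

/-- The function `1 / (exp x - 1)`. -/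
noncomputable def bose (x : ℂ) : ℂ := (Complex.exp x - 1)⁻¹

/-- The product of `1 / (exp (tᵢ + tⱼ) - 1)` over the three pairs `i ≠ j`, whose Mellin transform
is, up to Gamma factors, the symmetric zeta function. -/
noncomputable def pairBose (t : Fin 3 → ℝ) : ℂ :=
  bose (t 0 + t 1) * bose (t 1 + t 2) * bose (t 2 + t 0)

theorem mul_exp_half_le_exp_sub_one {x : ℝ} (hx : 0 ≤ x) : x * Real.exp (x / 2) ≤ Real.exp x - 1 := by
  have h1 : x / 2 ≤ Real.sinh (x / 2) := Real.self_le_sinh_iff.2 (by linarith)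
  rw [Real.sinh_eq] at h1
  have h2 : Real.exp x = Real.exp (x / 2) * Real.exp (x / 2) := by rw [← Real.exp_add]; ring_nf
  have h3 : Real.exp (-(x / 2)) * Real.exp (x / 2) = 1 := by rw [← Real.exp_add]; simp
  have h4 := Real.exp_pos (x / 2)
  nlinarith

theorem bose_ofReal (x : ℝ) : bose x = ((Real.exp x - 1)⁻¹ : ℝ) := by
  simp [bose]

theorem inv_exp_sub_one_pos {x : ℝ} (hx : 0 < x) : 0 < (Real.exp x - 1)⁻¹ :=
  inv_pos.2 (by linarith [Real.add_one_lt_exp hx.ne'])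

theorem inv_exp_add_sub_one_sq_le {x y : ℝ} (hx : 0 < x) (hy : 0 < y) :
    ((Real.exp (x + y) - 1)⁻¹) ^ 2 ≤ (Real.exp x - 1)⁻¹ * (Real.exp y - 1)⁻¹ := by
  have h1 : 0 < Real.exp x - 1 := by linarith [Real.add_one_lt_exp hx.ne']
  have h2 : 0 < Real.exp y - 1 := by linarith [Real.add_one_lt_exp hy.ne']
  rw [inv_pow, ← mul_inv]
  refine inv_anti₀ (mul_pos h1 h2) ?_
  have h3 : Real.exp x ≤ Real.exp (x + y) := Real.exp_le_exp.2 (by linarith)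
  have h4 : Real.exp y ≤ Real.exp (x + y) := Real.exp_le_exp.2 (by linarith)
  rw [sq]
  exact mul_le_mul (by linarith) (by linarith) h2.le (by linarith)

theorem pairBose_eq_ofReal (t : Fin 3 → ℝ) : pairBose t =
    ((Real.exp (t 0 + t 1) - 1)⁻¹ * (Real.exp (t 1 + t 2) - 1)⁻¹ *
      (Real.exp (t 2 + t 0) - 1)⁻¹ : ℝ) := by
  simp only [pairBose, ← Complex.ofReal_add, bose_ofReal, Complex.ofReal_mul]

theorem norm_pairBose_le {t : Fin 3 → ℝ} (ht : t ∈ octant 3) :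
    ‖pairBose t‖ ≤ ∏ i, ((t i)⁻¹ * Real.exp (-(1 / 2) * t i)) := by
  have h := mem_octant.1 ht
  have hp := inv_exp_sub_one_pos (add_pos (h 0) (h 1))
  have hq := inv_exp_sub_one_pos (add_pos (h 1) (h 2))
  have hr := inv_exp_sub_one_pos (add_pos (h 2) (h 0))
  have h0 := inv_exp_sub_one_pos (h 0)
  have h1 := inv_exp_sub_one_pos (h 1)
  have h2 := inv_exp_sub_one_pos (h 2)
  have key : ∀ i, (Real.exp (t i) - 1)⁻¹ ≤ (t i)⁻¹ * Real.exp (-(1 / 2) * t i) := by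
    intro i
    have h3 := mul_exp_half_le_exp_sub_one (h i).le
    have h4 : 0 < t i * Real.exp (t i / 2) := mul_pos (h i) (Real.exp_pos _)
    refine (inv_anti₀ h4 h3).trans (le_of_eq ?_)
    rw [mul_inv, ← Real.exp_neg]
    ring_nf
  rw [pairBose_eq_ofReal, Complex.norm_real, Real.norm_of_nonneg (by positivity)]
  refine le_trans ?_ (Finset.prod_le_prod (fun i _ => (inv_exp_sub_one_pos (h i)).le)
    fun i _ => key i)
  rw [Fin.prod_univ_three]
  refine le_of_sq_le_sq ?_ (by positivity)
  calc _ = ((Real.exp (t 0 + t 1) - 1)⁻¹) ^ 2 * ((Real.exp (t 1 + t 2) - 1)⁻¹) ^ 2 *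
        ((Real.exp (t 2 + t 0) - 1)⁻¹) ^ 2 := by ring
    _ ≤ ((Real.exp (t 0) - 1)⁻¹ * (Real.exp (t 1) - 1)⁻¹) *
        ((Real.exp (t 1) - 1)⁻¹ * (Real.exp (t 2) - 1)⁻¹) *
        ((Real.exp (t 2) - 1)⁻¹ * (Real.exp (t 0) - 1)⁻¹) := by
      gcongr ?_ * ?_ * ?_
      · exact inv_exp_add_sub_one_sq_le (h 0) (h 1)
      · exact inv_exp_add_sub_one_sq_le (h 1) (h 2)
      · exact inv_exp_add_sub_one_sq_le (h 2) (h 0)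
    _ = _ := by ring

theorem measurable_pairBose : Measurable pairBose := by
  unfold pairBose bose
  fun_prop

theorem mellinPiConvergent_pairBose {s : Fin 3 → ℂ} (hs : ∀ i, 1 < (s i).re) :
    MellinPiConvergent pairBose s := by
  have h1 : IntegrableOn (fun t : Fin 3 → ℝ => ∏ i, t i ^ ((s i).re - 1 - 1) *
      (t i ^ 0 * Real.exp (-(1 / 2) * t i))) (octant 3) := by
    refine integrableOn_octant_prod (f := fun i x => x ^ ((s i).re - 1 - 1) *
      (x ^ 0 * Real.exp (-(1 / 2) * x))) fun i =>
      integrableOn_rpow_mul_pow_mul_exp (K := 0) ?_ (by norm_num)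
    simpa using hs i
  refine h1.mono' ((measurable_mellinKernel s).mul measurable_pairBose).aestronglyMeasurable
    ((ae_restrict_iff' (measurableSet_octant 3)).2 (Eventually.of_forall fun t ht => ?_))
  rw [norm_mul, norm_mellinKernel s ht]
  refine (mul_le_mul_of_nonneg_left (norm_pairBose_le ht) (Finset.prod_nonneg fun i _ =>
    Real.rpow_nonneg (mem_octant.1 ht i).le _)).trans (le_of_eq ?_)
  rw [← Finset.prod_mul_distrib]
  refine Finset.prod_congr rfl fun i _ => ?_
  rw [Real.rpow_sub_one (mem_octant.1 ht i).ne' ((s i).re - 1), pow_zero, one_mul]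
  ring

theorem hasSum_pnat_pow {r : ℝ} (h0 : 0 ≤ r) (h1 : r < 1) :
    HasSum (fun n : ℕ+ => r ^ (n : ℕ)) (r * (1 - r)⁻¹) := by
  rw [← Equiv.pnatEquivNat.symm.hasSum_iff]
  refine ((hasSum_geometric_of_lt_one h0 h1).mul_left r).congr_fun fun n => ?_
  simp [pow_succ']

theorem hasSum_exp_neg_mul {x : ℝ} (hx : 0 < x) :
    HasSum (fun n : ℕ+ => Real.exp (-(n * x))) (Real.exp x - 1)⁻¹ := by
  have h := hasSum_pnat_pow (Real.exp_pos (-x)).le (Real.exp_lt_one_iff.2 (neg_lt_zero.2 hx))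
  have h1 : Real.exp (-x) * (1 - Real.exp (-x))⁻¹ = (Real.exp x - 1)⁻¹ := by
    have := (Real.exp_pos x).ne'
    rw [Real.exp_neg, ← div_eq_mul_inv, inv_eq_one_div]
    have h3 : Real.exp x - 1 ≠ 0 := by linarith [Real.add_one_lt_exp hx.ne']
    field_simp
  rw [h1] at h
  refine h.congr_fun fun n => ?_
  rw [← Real.exp_nat_mul]
  ring_nf

theorem hasSum_pairBose {t : Fin 3 → ℝ} (ht : t ∈ octant 3) :
    HasSum (fun n : ℕ+ × ℕ+ × ℕ+ => Real.exp (-(n.1 * (t 2 + t 0))) *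
      (Real.exp (-(n.2.1 * (t 0 + t 1))) * Real.exp (-(n.2.2 * (t 1 + t 2)))))
      ((Real.exp (t 0 + t 1) - 1)⁻¹ * (Real.exp (t 1 + t 2) - 1)⁻¹ *
      (Real.exp (t 2 + t 0) - 1)⁻¹) := by
  have h := mem_octant.1 ht
  have ha := hasSum_exp_neg_mul (add_pos (h 2) (h 0))
  have hb := hasSum_exp_neg_mul (add_pos (h 0) (h 1))
  have hc := hasSum_exp_neg_mul (add_pos (h 1) (h 2))
  have hbc := hb.mul hc (hb.summable.mul_of_nonneg hc.summable (fun _ => Real.exp_nonneg _)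
    fun _ => Real.exp_nonneg _)
  have habc := ha.mul hbc (ha.summable.mul_of_nonneg hbc.summable (fun _ => Real.exp_nonneg _)
    fun _ => mul_nonneg (Real.exp_nonneg _) (Real.exp_nonneg _))
  rw [mul_comm] at habc
  exact habc

theorem exp_neg_pairs (t : Fin 3 → ℝ) (a b c : ℝ) :
    ((Real.exp (-(a * (t 2 + t 0))) * (Real.exp (-(b * (t 0 + t 1))) *
      Real.exp (-(c * (t 1 + t 2)))) : ℝ) : ℂ) =
    ∏ i, Complex.exp (-((![a + b, b + c, c + a] i : ℝ) * (t i : ℂ))) := by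
  rw [Fin.prod_univ_three, ← Real.exp_add, ← Real.exp_add, ← Complex.exp_add, ← Complex.exp_add,
    Complex.ofReal_exp]
  congr 1
  simp
  ring

theorem hasSum_symZetaTerm {s : Fin 3 → ℂ} (hs : ∀ i, 1 < (s i).re) :
    HasSum (fun n => (∏ i, Complex.Gamma (s i)) * symZetaTerm s n) (mellinPi pairBose s) := by
  have hterm : ∀ n : ℕ+ × ℕ+ × ℕ+, ∫ t in octant 3, mellinKernel s t *
      ((Real.exp (-(n.1 * (t 2 + t 0))) * (Real.exp (-(n.2.1 * (t 0 + t 1))) *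
      Real.exp (-(n.2.2 * (t 1 + t 2)))) : ℝ) : ℂ) =
      (∏ i, Complex.Gamma (s i)) * symZetaTerm s n := by
    rintro ⟨a, b, c⟩
    have hpos : ∀ i, (0 : ℝ) < ![(a : ℝ) + b, b + c, c + a] i := by
      intro i
      fin_cases i <;> simp <;> positivity
    simp only [exp_neg_pairs, mellinKernel, ← Finset.prod_mul_distrib]
    rw [integral_octant_prod (fun i x => (x : ℂ) ^ (s i - 1) *
      Complex.exp (-((![(a : ℝ) + b, b + c, c + a] i : ℝ) * (x : ℂ))))]
    have h1 := fun i => Complex.integral_cpow_mul_exp_neg_mul_Ioi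
      (a := s i) (by linarith [hs i]) (hpos i)
    simp only [h1]
    rw [Finset.prod_mul_distrib, mul_comm]
    congr 1
    have h2 : ∀ i, (1 / ((![(a : ℝ) + b, b + c, c + a] i : ℝ) : ℂ)) ^ s i =
        (((![(a : ℝ) + b, b + c, c + a] i : ℝ) : ℂ) ^ s i)⁻¹ := by
      intro i
      rw [one_div, Complex.inv_cpow]
      rw [Complex.arg_ofReal_of_nonneg (hpos i).le]
      exact Real.pi_pos.ne
    simp only [h2, Fin.prod_univ_three, symZetaTerm]
    simp [mul_comm, mul_assoc]
  have main := hasSum_integral_of_dominated_convergence (μ := volume.restrict (octant 3))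
    (F := fun (n : ℕ+ × ℕ+ × ℕ+) t => mellinKernel s t *
      ((Real.exp (-(n.1 * (t 2 + t 0))) * (Real.exp (-(n.2.1 * (t 0 + t 1))) *
      Real.exp (-(n.2.2 * (t 1 + t 2)))) : ℝ) : ℂ))
    (f := fun t => mellinKernel s t * pairBose t)
    (fun n t => ‖mellinKernel s t‖ *
      (Real.exp (-(n.1 * (t 2 + t 0))) * (Real.exp (-(n.2.1 * (t 0 + t 1))) *
      Real.exp (-(n.2.2 * (t 1 + t 2)))))) ?_ ?_ ?_ ?_ ?_
  · simp only [hterm] at main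
    exact main
  · intro n
    refine ((measurable_mellinKernel s).mul ?_).aestronglyMeasurable
    fun_prop
  · intro n
    refine Eventually.of_forall fun t => le_of_eq ?_
    rw [norm_mul, Complex.norm_real, Real.norm_of_nonneg (by positivity)]
  · refine (ae_restrict_iff' (measurableSet_octant 3)).2 (Eventually.of_forall fun t ht => ?_)
    exact (hasSum_pairBose ht).summable.mul_left _
  · refine (IntegrableOn.congr_fun (mellinPiConvergent_pairBose hs).norm (fun t ht => ?_)
      (measurableSet_octant 3))
    have h := mem_octant.1 ht
    have h01 := inv_exp_sub_one_pos (add_pos (h 0) (h 1))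
    have h12 := inv_exp_sub_one_pos (add_pos (h 1) (h 2))
    have h20 := inv_exp_sub_one_pos (add_pos (h 2) (h 0))
    rw [((hasSum_pairBose ht).mul_left _).tsum_eq, norm_mul, pairBose_eq_ofReal,
      Complex.norm_real, Real.norm_of_nonneg (by positivity)]
  · refine (ae_restrict_iff' (measurableSet_octant 3)).2 (Eventually.of_forall fun t ht => ?_)
    rw [pairBose_eq_ofReal]
    exact (Complex.hasSum_ofReal.2 (hasSum_pairBose ht)).mul_left _

end

section

open Metric

/-- Iterated dyadic differences: `χ ↦ χ (2 x) - 2 ^ k χ x` for `k < N`, which annihilates the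
Taylor polynomial of degree `N - 1` at the origin. -/
noncomputable def dyadicDiff : ℕ → (ℂ → ℂ) → ℂ → ℂ
  | 0, χ, x => χ x
  | N + 1, χ, x => dyadicDiff N χ (2 * x) - 2 ^ N * dyadicDiff N χ x

theorem dyadicDiff_eq_pow_mul (N : ℕ) : ∃ C : ℝ, 0 ≤ C ∧ ∀ (χ : ℂ → ℂ) (r B : ℝ), 0 < r → 0 ≤ B →
    DifferentiableOn ℂ χ (ball 0 r) → (∀ z ∈ ball (0 : ℂ) r, ‖χ z‖ ≤ B) →
    ∃ ξ : ℂ → ℂ, DifferentiableOn ℂ ξ (ball 0 (r / 2 ^ N)) ∧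
      ∀ z ∈ ball (0 : ℂ) (r / 2 ^ N), ‖ξ z‖ ≤ C * B / r ^ N ∧ dyadicDiff N χ z = z ^ N * ξ z := by
  induction N with
  | zero =>
    refine ⟨1, zero_le_one, fun χ r B hr hB hχ hb => ⟨χ, by simpa using hχ, fun z hz => ?_⟩⟩
    rw [pow_zero, div_one] at hz
    simpa [dyadicDiff] using hb z hz
  | succ N ih =>
    obtain ⟨C, hC, h⟩ := ih
    refine ⟨2 ^ N * (2 * C) * 2 ^ (N + 1), by positivity, fun χ r B hr hB hχ hb => ?_⟩
    obtain ⟨ξ, hξ, hξb⟩ := h χ r B hr hB hχ hb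
    have hr' : 0 < r / 2 ^ (N + 1) := by positivity
    have hmem : ∀ z ∈ ball (0 : ℂ) (r / 2 ^ (N + 1)), z ∈ ball (0 : ℂ) (r / 2 ^ N) ∧
        2 * z ∈ ball (0 : ℂ) (r / 2 ^ N) := by
      intro z hz
      rw [mem_ball_zero_iff, pow_succ, ← div_div, lt_div_iff₀ two_pos] at hz
      rw [mem_ball_zero_iff, mem_ball_zero_iff, norm_mul, Complex.norm_ofNat]
      constructor <;> linarith [norm_nonneg z]
    let ψ : ℂ → ℂ := fun z => ξ (2 * z) - ξ z
    have hψ : DifferentiableOn ℂ ψ (ball 0 (r / 2 ^ (N + 1))) :=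
      (hξ.comp (by fun_prop) fun z hz => (hmem z hz).2).sub (hξ.mono fun z hz => (hmem z hz).1)
    have hψ0 : ψ 0 = 0 := by simp [ψ]
    have hψb : ∀ z ∈ ball (0 : ℂ) (r / 2 ^ (N + 1)), ‖ψ z‖ ≤ 2 * (C * B / r ^ N) := by
      intro z hz
      refine (norm_sub_le _ _).trans ?_
      linarith [(hξb _ (hmem z hz).1).1, (hξb _ (hmem z hz).2).1]
    refine ⟨fun z => 2 ^ N * dslope ψ 0 z, ?_, fun z hz => ⟨?_, ?_⟩⟩
    · exact ((Complex.differentiableOn_dslope (ball_mem_nhds _ hr')).2 hψ).const_mul _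
    · have h1 := Complex.norm_dslope_le_div_of_mapsTo_ball (R₂ := 2 * (C * B / r ^ N)) hψ
        (fun w hw => by
          rw [hψ0]
          simpa using hψb w hw) hz
      rw [norm_mul, norm_pow, Complex.norm_ofNat]
      calc _ ≤ 2 ^ N * (2 * (C * B / r ^ N) / (r / 2 ^ (N + 1))) := by gcongr
        _ = _ := by
          field_simp
          ring
    · have h1 : z * dslope ψ 0 z = ψ z := by
        have := sub_smul_dslope ψ 0 z
        rwa [sub_zero, hψ0, sub_zero, smul_eq_mul] at this
      have h2 := (hξb _ (hmem z hz).1).2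
      have h3 := (hξb _ (hmem z hz).2).2
      rw [dyadicDiff, h2, h3]
      simp only [ψ] at h1
      linear_combination -(2 ^ N * z ^ N) * h1

theorem dyadicDiff_eq_sum (N : ℕ) : ∃ a : ℕ → ℂ, ∀ (χ : ℂ → ℂ) (x : ℂ),
    dyadicDiff N χ x = ∑ j ∈ Finset.range (N + 1), a j * χ (2 ^ j * x) := by
  induction N with
  | zero => exact ⟨fun _ => 1, fun χ x => by simp [dyadicDiff]⟩
  | succ N ih =>
    obtain ⟨a, ha⟩ := ih
    refine ⟨fun j => (if j = 0 then 0 else a (j - 1)) - 2 ^ N * (if j = N + 1 then 0 else a j),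
      fun χ x => ?_⟩
    rw [dyadicDiff, ha, ha]
    simp only [sub_mul, Finset.sum_sub_distrib]
    congr 1
    · conv_rhs => rw [Finset.sum_range_succ']
      simp only [Nat.add_eq_zero_iff, one_ne_zero, and_false, if_false, Nat.add_sub_cancel, if_true,
        zero_mul, add_zero]
      exact Finset.sum_congr rfl fun j _ => by rw [pow_succ, mul_assoc]
    · conv_rhs => rw [Finset.sum_range_succ, if_pos rfl, mul_zero, zero_mul, add_zero]
      rw [Finset.mul_sum]
      refine Finset.sum_congr rfl fun j hj => ?_
      rw [if_neg (by rw [Finset.mem_range] at hj; omega), mul_assoc]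

theorem norm_dyadicDiff_le (N : ℕ) : ∃ C : ℝ, 0 ≤ C ∧ ∀ (χ : ℂ → ℂ) (x : ℂ) (B : ℝ),
    (∀ j ≤ N, ‖χ (2 ^ j * x)‖ ≤ B) → ‖dyadicDiff N χ x‖ ≤ C * B := by
  obtain ⟨a, ha⟩ := dyadicDiff_eq_sum N
  refine ⟨∑ j ∈ Finset.range (N + 1), ‖a j‖, Finset.sum_nonneg fun _ _ => norm_nonneg _,
    fun χ x B h => ?_⟩
  rw [ha, Finset.sum_mul]
  refine (norm_sum_le _ _).trans (Finset.sum_le_sum fun j hj => ?_)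
  rw [norm_mul]
  exact mul_le_mul_of_nonneg_left (h j (Nat.lt_succ_iff.1 (Finset.mem_range.1 hj))) (norm_nonneg _)

/-- A bounded function that is holomorphic on a disc of radius `r` has dyadic differences of size
`(|x| / r) ^ N`. -/
theorem norm_dyadicDiff_le_pow (N : ℕ) : ∃ C : ℝ, 0 ≤ C ∧ ∀ (χ : ℂ → ℂ) (r B : ℝ) (x : ℂ), 0 < r →
    DifferentiableOn ℂ χ (ball 0 r) → (∀ z ∈ ball (0 : ℂ) r, ‖χ z‖ ≤ B) →
    (∀ j ≤ N, ‖χ (2 ^ j * x)‖ ≤ B) → ‖dyadicDiff N χ x‖ ≤ C * B * (‖x‖ / r) ^ N := by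
  obtain ⟨C₁, hC₁, h₁⟩ := dyadicDiff_eq_pow_mul N
  obtain ⟨C₂, hC₂, h₂⟩ := norm_dyadicDiff_le N
  refine ⟨C₁ + C₂ * (2 ^ N) ^ N, by positivity, fun χ r B x hr hχ hb hx => ?_⟩
  have hB : 0 ≤ B := (norm_nonneg _).trans (hx 0 (Nat.zero_le _))
  rcases lt_or_ge ‖x‖ (r / 2 ^ N) with hlt | hge
  · obtain ⟨ξ, -, hξ⟩ := h₁ χ r B hr hB hχ hb
    obtain ⟨h3, h4⟩ := hξ x (by simpa using hlt)
    rw [h4, norm_mul, norm_pow]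
    calc _ ≤ ‖x‖ ^ N * (C₁ * B / r ^ N) := by gcongr
      _ = C₁ * B * (‖x‖ / r) ^ N := by rw [div_pow]; ring
      _ ≤ _ := by
        have : 0 ≤ C₂ * (2 ^ N) ^ N := by positivity
        gcongr
        linarith
  · refine (h₂ χ x B hx).trans ?_
    have h5 : 1 ≤ 2 ^ N * (‖x‖ / r) := by
      rw [div_le_iff₀ (by positivity)] at hge
      rw [← mul_div_assoc, le_div_iff₀ hr]
      linarith
    have h6 : 1 ≤ (2 ^ N) ^ N * (‖x‖ / r) ^ N := by
      rw [← mul_pow]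
      exact one_le_pow₀ h5
    calc C₂ * B = C₂ * B * 1 := by ring
      _ ≤ C₂ * B * ((2 ^ N) ^ N * (‖x‖ / r) ^ N) := by gcongr
      _ = C₂ * (2 ^ N) ^ N * B * (‖x‖ / r) ^ N := by ring
      _ ≤ _ := by
        gcongr
        linarith

theorem differentiableAt_dyadicDiff {N : ℕ} {h : ℂ → ℂ → ℂ} {v x : ℂ}
    (hd : ∀ j ≤ N, DifferentiableAt ℂ (fun v => h v (2 ^ j * x)) v) :
    DifferentiableAt ℂ (fun v => dyadicDiff N (h v) x) v := by
  obtain ⟨a, ha⟩ := dyadicDiff_eq_sum N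
  simp only [ha]
  refine DifferentiableAt.fun_sum fun j hj => ?_
  exact (hd j (Nat.lt_succ_iff.1 (Finset.mem_range.1 hj))).const_mul _

/-- The function `x / (exp x - 1)`, extended by `1` at the origin. -/
noncomputable def todd (x : ℂ) : ℂ := (dslope Complex.exp 0 x)⁻¹

theorem bose_eq_todd_div (x : ℂ) : bose x = todd x * x⁻¹ := by
  rcases eq_or_ne x 0 with rfl | hx
  · simp [bose]
  · rw [bose, todd, dslope_of_ne _ hx, slope_def_field, sub_zero, Complex.exp_zero, inv_div,
      div_eq_mul_inv, mul_right_comm, mul_inv_cancel₀ hx, one_mul]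

/-- A region in which `todd` is holomorphic and bounded. -/
def ToddRegion (x : ℂ) : Prop := ‖x‖ < 1 / 2 ∨ (0 < x.re ∧ |x.im| ≤ x.re)

theorem ToddRegion.dslope_ne_zero_and_norm_le {x : ℂ} (hx : ToddRegion x) :
    dslope Complex.exp 0 x ≠ 0 ∧ ‖todd x‖ ≤ 4 * Real.exp (-x.re / 2) := by
  rcases hx with hx | ⟨hx, hx'⟩
  · have h1 : 1 / 2 ≤ ‖dslope Complex.exp 0 x‖ := by
      rcases eq_or_ne x 0 with rfl | h0
      · simp
        norm_num
      · have h2 := Complex.norm_exp_sub_one_sub_id_le (x := x) (by linarith)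
        rw [dslope_of_ne _ h0, slope_def_field, sub_zero, Complex.exp_zero, norm_div,
          le_div_iff₀ (norm_pos_iff.2 h0)]
        have h3 : ‖x‖ ≤ ‖Complex.exp x - 1‖ + ‖Complex.exp x - 1 - x‖ := by
          have := norm_sub_le (Complex.exp x - 1) (Complex.exp x - 1 - x)
          rwa [sub_sub_cancel] at this
        nlinarith [norm_nonneg x]
    refine ⟨fun h => by rw [h, norm_zero] at h1; norm_num at h1, ?_⟩
    have h4 : ‖todd x‖ ≤ 2 := by
      rw [todd, norm_inv]
      exact inv_le_of_inv_le₀ two_pos (by linarith)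
    have h5 : x.re ≤ 1 / 2 := (Complex.re_le_norm x).trans hx.le
    have h6 := Real.add_one_le_exp (-x.re / 2)
    linarith
  · have h0 : x ≠ 0 := by
      rintro rfl
      simp at hx
    have h1 := mul_exp_half_le_exp_sub_one hx.le
    have h2 : Real.exp x.re - 1 ≤ ‖Complex.exp x - 1‖ := by
      have := norm_sub_norm_le (Complex.exp x) 1
      rwa [Complex.norm_exp, norm_one] at this
    have h3 : ‖x‖ ≤ 2 * x.re := by
      refine (Complex.norm_le_abs_re_add_abs_im x).trans ?_
      rw [abs_of_pos hx]
      linarith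
    have h4 : 0 < x.re * Real.exp (x.re / 2) := mul_pos hx (Real.exp_pos _)
    have h5 : 0 < ‖Complex.exp x - 1‖ := by linarith
    refine ⟨?_, ?_⟩
    · rw [dslope_of_ne _ h0, slope_def_field, sub_zero, Complex.exp_zero]
      exact div_ne_zero (norm_pos_iff.1 h5) h0
    · rw [todd, dslope_of_ne _ h0, slope_def_field, sub_zero, Complex.exp_zero, inv_div, norm_div,
        div_le_iff₀ h5]
      have h6 : Real.exp (-x.re / 2) * Real.exp (x.re / 2) = 1 := by
        rw [← Real.exp_add]
        ring_nf
        simp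
      calc ‖x‖ ≤ 2 * x.re := h3
        _ = 2 * Real.exp (-x.re / 2) * (x.re * Real.exp (x.re / 2)) := by
          linear_combination (-2 * x.re) * h6
        _ ≤ 2 * Real.exp (-x.re / 2) * ‖Complex.exp x - 1‖ := by
          gcongr
          linarith
        _ ≤ _ := by
          gcongr
          norm_num

theorem ToddRegion.differentiableAt {x : ℂ} (hx : ToddRegion x) : DifferentiableAt ℂ todd x := by
  have h : DifferentiableOn ℂ (dslope Complex.exp 0) Set.univ :=
    (Complex.differentiableOn_dslope univ_mem).2 Complex.differentiable_exp.differentiableOn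
  exact (h.differentiableAt univ_mem).inv hx.dslope_ne_zero_and_norm_le.1

theorem ToddRegion.norm_le_const {x : ℂ} (hx : ToddRegion x) : ‖todd x‖ ≤ 8 := by
  refine hx.dslope_ne_zero_and_norm_le.2.trans ?_
  have h1 : -1 / 2 ≤ x.re := by
    rcases hx with hx | ⟨hx, -⟩
    · linarith [abs_le.1 (Complex.abs_re_le_norm x)]
    · linarith
  have h2 : Real.exp (-x.re / 2) ≤ Real.exp 1 := Real.exp_le_exp.2 (by linarith)
  have h3 : Real.exp (-x.re / 2) * Real.exp (x.re / 2) = 1 := by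
    rw [← Real.exp_add]
    ring_nf
    simp
  have h4 := Real.add_one_le_exp (x.re / 2)
  nlinarith [Real.exp_pos (-x.re / 2)]

end

section

open Metric

/-- The regular factor of the product `pairBose` in the coordinates `(u, u v, u v w)`. -/
noncomputable def sectorFactor (u v w : ℂ) : ℂ :=
  todd (u * (1 + v)) * todd (u * (1 + v * w)) * todd (u * v * (1 + w)) *
    ((1 + v)⁻¹ * (1 + v * w)⁻¹ * (1 + w)⁻¹)

/-- Positive reals up to `V`, together with the disc of radius `r`. -/
def RealOrSmall (V r : ℝ) (v : ℂ) : Prop := (∃ x : ℝ, 0 < x ∧ x ≤ V ∧ v = x) ∨ ‖v‖ < r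

/-- Positive reals, together with the disc of radius `r`. -/
def PosOrSmall (r : ℝ) (u : ℂ) : Prop := (∃ x : ℝ, 0 < x ∧ u = x) ∨ ‖u‖ < r

theorem RealOrSmall.mono {V r r' : ℝ} {v : ℂ} (h : RealOrSmall V r v) (hr : r ≤ r') :
    RealOrSmall V r' v := h.imp_right fun h => h.trans_le hr

theorem RealOrSmall.norm_le {V r : ℝ} {v : ℂ} (h : RealOrSmall V r v) (hV : 1 ≤ V) (hr : r ≤ 1) :
    ‖v‖ ≤ V := by
  rcases h with ⟨x, hx, hxV, rfl⟩ | h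
  · rwa [Complex.norm_real, Real.norm_of_nonneg hx.le]
  · linarith

/-- Points close to the real half-line `[1, L]`. -/
def NearReal (L : ℝ) (y : ℂ) : Prop := 1 / 2 ≤ y.re ∧ |y.im| ≤ 1 / 2 ∧ ‖y‖ ≤ L

theorem NearReal.norm_inv_le {L : ℝ} {y : ℂ} (h : NearReal L y) : y ≠ 0 ∧ ‖y⁻¹‖ ≤ 2 := by
  have h1 : 1 / 2 ≤ ‖y‖ := h.1.trans (Complex.re_le_norm y)
  have h2 : 0 < ‖y‖ := by linarith
  refine ⟨norm_pos_iff.1 h2, ?_⟩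
  rw [norm_inv]
  exact inv_le_of_inv_le₀ two_pos (by linarith)

theorem nearReal_one_add {V r L : ℝ} {v : ℂ} (h : RealOrSmall V r v) (hr : r ≤ 1 / 8)
    (hV : 1 ≤ V) (hL : 1 + V ≤ L) : NearReal L (1 + v) := by
  have h1 : ‖1 + v‖ ≤ L := by
    have := norm_add_le 1 v
    rw [norm_one] at this
    linarith [h.norm_le hV (by linarith)]
  rcases h with ⟨x, hx, hxV, rfl⟩ | h
  · refine ⟨?_, ?_, h1⟩
    · simp
      linarith
    · simp
  · have h2 := abs_le.1 (Complex.abs_re_le_norm v)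
    have h3 := Complex.abs_im_le_norm v
    refine ⟨?_, ?_, h1⟩
    · simp
      linarith
    · simp
      linarith

theorem RealOrSmall.mul {V r : ℝ} {v w : ℂ} (hv : RealOrSmall V r v) (hw : RealOrSmall V r w)
    (hV : 1 ≤ V) (hr : r * V ≤ 1) (hr0 : 0 < r) :
    RealOrSmall (V * V) (r * V) (v * w) := by
  have hr1 : r ≤ 1 := by nlinarith
  have hv' := hv.norm_le hV hr1
  have hw' := hw.norm_le hV hr1
  rcases hv with ⟨x, hx, hxV, rfl⟩ | hv
  · rcases hw with ⟨y, hy, hyV, rfl⟩ | hw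
    · exact Or.inl ⟨x * y, mul_pos hx hy, mul_le_mul hxV hyV hy.le (by linarith), by push_cast; rfl⟩
    · right
      rw [norm_mul]
      nlinarith [norm_nonneg w]
  · right
    rw [norm_mul]
    nlinarith [norm_nonneg v]

theorem toddRegion_mul {L r : ℝ} {u y : ℂ} (hu : PosOrSmall r u) (hy : NearReal L y)
    (hL : r * L < 1 / 2) (hr : 0 < r) : ToddRegion (u * y) := by
  rcases hu with ⟨x, hx, rfl⟩ | hu
  · right
    rw [Complex.re_ofReal_mul, Complex.im_ofReal_mul, abs_mul, abs_of_pos hx]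
    exact ⟨mul_pos hx (by linarith [hy.1]),
      mul_le_mul_of_nonneg_left (by linarith [hy.1, hy.2.1]) hx.le⟩
  · left
    rw [norm_mul]
    have := hy.2.2
    nlinarith [norm_nonneg u, norm_nonneg y]

section

variable {V : ℝ}

/-- The admissible domain for `sectorFactor`. -/
structure SectorDomain (V r : ℝ) (u v w : ℂ) : Prop where
  left : PosOrSmall r u
  middle : RealOrSmall V (r / (1 + ‖u‖)) v
  right : RealOrSmall V r w

/-- A radius adapted to real parameters up to `V`. -/
noncomputable def sectorRadius (V : ℝ) : ℝ := (8 * (1 + V) ^ 2)⁻¹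

theorem sectorRadius_pos (hV : 1 ≤ V) : 0 < sectorRadius V := by
  unfold sectorRadius
  positivity

theorem sectorRadius_mul : 1 ≤ V → sectorRadius V * (1 + V) ^ 2 = 1 / 8 := fun hV => by
  unfold sectorRadius
  have : (1 + V) ≠ 0 := by linarith
  field_simp

theorem sectorRadius_le (hV : 1 ≤ V) : sectorRadius V ≤ 1 / 8 := by
  have h1 := sectorRadius_mul hV
  have h2 := sectorRadius_pos hV
  nlinarith

theorem sectorRadius_mul_le (hV : 1 ≤ V) : sectorRadius V * V ≤ 1 / 8 := by
  have h1 := sectorRadius_mul hV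
  have h2 := sectorRadius_pos hV
  nlinarith

variable {u v w : ℂ} (h : SectorDomain V (sectorRadius V) u v w) (hV : 1 ≤ V)
include h hV

theorem SectorDomain.nearReal : NearReal ((1 + V) ^ 2) (1 + v) ∧
    NearReal ((1 + V) ^ 2) (1 + v * w) ∧ NearReal ((1 + V) ^ 2) (1 + w) := by
  have hr := sectorRadius_le hV
  have hr0 := sectorRadius_pos hV
  have hv : RealOrSmall V (sectorRadius V) v :=
    h.middle.mono (div_le_self hr0.le (by linarith [norm_nonneg u]))
  have hm := sectorRadius_mul_le hV
  refine ⟨nearReal_one_add hv hr hV (by nlinarith), ?_, nearReal_one_add h.right hr hV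
    (by nlinarith)⟩
  exact nearReal_one_add (hv.mul h.right hV (by linarith) hr0) hm (by nlinarith) (by nlinarith)

theorem SectorDomain.toddRegion : ToddRegion (u * (1 + v)) ∧ ToddRegion (u * (1 + v * w)) ∧
    ToddRegion (u * v * (1 + w)) := by
  obtain ⟨h1, h2, h3⟩ := h.nearReal hV
  have hr0 := sectorRadius_pos hV
  have hrL : sectorRadius V * (1 + V) ^ 2 < 1 / 2 := by
    rw [sectorRadius_mul hV]
    norm_num
  refine ⟨toddRegion_mul h.left h1 hrL hr0, toddRegion_mul h.left h2 hrL hr0, ?_⟩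
  have hV0 : 0 < V := by linarith
  have huv : PosOrSmall (sectorRadius V * V) (u * v) := by
    rcases h.left with ⟨x, hx, rfl⟩ | hu
    · rcases h.middle with ⟨y, hy, -, rfl⟩ | hv
      · exact Or.inl ⟨x * y, mul_pos hx hy, by push_cast; rfl⟩
      · right
        rw [Complex.norm_real, Real.norm_of_nonneg hx.le, lt_div_iff₀ (by linarith)] at hv
        rw [norm_mul, Complex.norm_real, Real.norm_of_nonneg hx.le]
        nlinarith [norm_nonneg v]
    · right
      have hv := h.middle.norm_le hV ((div_le_self hr0.le (by linarith [norm_nonneg u])).trans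
        (by linarith [sectorRadius_le hV]))
      rw [norm_mul]
      nlinarith [norm_nonneg u]
  have hw' : NearReal (1 + V) (1 + w) := nearReal_one_add h.right (sectorRadius_le hV) hV le_rfl
  refine toddRegion_mul huv hw' ?_ (mul_pos hr0 hV0)
  nlinarith [sectorRadius_mul hV]

theorem SectorDomain.norm_sectorFactor_le :
    ‖sectorFactor u v w‖ ≤ 4096 * Real.exp (-‖u‖ / 4) := by
  obtain ⟨h1, h2, h3⟩ := h.nearReal hV
  obtain ⟨t1, t2, t3⟩ := h.toddRegion hV
  have key : ‖todd (u * (1 + v))‖ ≤ 8 * Real.exp (-‖u‖ / 4) := by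
    rcases h.left with ⟨x, hx, rfl⟩ | hu
    · refine t1.dslope_ne_zero_and_norm_le.2.trans ?_
      rw [Complex.re_ofReal_mul, Complex.norm_real, Real.norm_of_nonneg hx.le]
      refine mul_le_mul (by norm_num) (Real.exp_le_exp.2 ?_) (Real.exp_nonneg _) (by norm_num)
      nlinarith [h1.1]
    · have h4 : ‖u * (1 + v)‖ ≤ 1 / 8 := by
        rw [norm_mul, ← sectorRadius_mul hV]
        exact mul_le_mul hu.le h1.2.2 (norm_nonneg _) (sectorRadius_pos hV).le
      refine t1.dslope_ne_zero_and_norm_le.2.trans ?_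
      have h5 := abs_le.1 (Complex.abs_re_le_norm (u * (1 + v)))
      have h6 : Real.exp (-(u * (1 + v)).re / 2) ≤ Real.exp (1 / 4) * Real.exp (-‖u‖ / 4) := by
        rw [← Real.exp_add]
        refine Real.exp_le_exp.2 ?_
        linarith [sectorRadius_le hV]
      have h7 : Real.exp (1 / 4) ≤ 2 := by
        have h8 : Real.exp (1 / 4) * Real.exp (-(1 / 4)) = 1 := by
          rw [← Real.exp_add]
          simp
        have h9 := Real.add_one_le_exp (-(1 / 4) : ℝ)
        nlinarith [Real.exp_pos (1 / 4)]
      nlinarith [Real.exp_pos (-‖u‖ / 4)]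
  rw [sectorFactor, norm_mul, norm_mul, norm_mul, norm_mul, norm_mul]
  calc _ ≤ 8 * Real.exp (-‖u‖ / 4) * 8 * 8 * (2 * 2 * 2) := by
        gcongr
        · exact t2.norm_le_const
        · exact t3.norm_le_const
        · exact h1.norm_inv_le.2
        · exact h2.norm_inv_le.2
        · exact h3.norm_inv_le.2
    _ = _ := by ring

theorem SectorDomain.differentiableAt : DifferentiableAt ℂ
    (fun p : ℂ × ℂ × ℂ => sectorFactor p.1 p.2.1 p.2.2) (u, v, w) := by
  obtain ⟨h1, h2, h3⟩ := h.nearReal hV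
  obtain ⟨t1, t2, t3⟩ := h.toddRegion hV
  have d1 : DifferentiableAt ℂ (fun p : ℂ × ℂ × ℂ => todd (p.1 * (1 + p.2.1))) (u, v, w) :=
    DifferentiableAt.comp (g := todd) (f := fun p : ℂ × ℂ × ℂ => p.1 * (1 + p.2.1)) (u, v, w)
      t1.differentiableAt (by fun_prop)
  have d2 : DifferentiableAt ℂ (fun p : ℂ × ℂ × ℂ => todd (p.1 * (1 + p.2.1 * p.2.2))) (u, v, w) :=
    DifferentiableAt.comp (g := todd) (f := fun p : ℂ × ℂ × ℂ => p.1 * (1 + p.2.1 * p.2.2))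
      (u, v, w) t2.differentiableAt (by fun_prop)
  have d3 : DifferentiableAt ℂ (fun p : ℂ × ℂ × ℂ => todd (p.1 * p.2.1 * (1 + p.2.2))) (u, v, w) :=
    DifferentiableAt.comp (g := todd) (f := fun p : ℂ × ℂ × ℂ => p.1 * p.2.1 * (1 + p.2.2))
      (u, v, w) t3.differentiableAt (by fun_prop)
  have e1 : DifferentiableAt ℂ (fun p : ℂ × ℂ × ℂ => (1 + p.2.1)⁻¹) (u, v, w) :=
    DifferentiableAt.inv (by fun_prop) h1.norm_inv_le.1
  have e2 : DifferentiableAt ℂ (fun p : ℂ × ℂ × ℂ => (1 + p.2.1 * p.2.2)⁻¹) (u, v, w) :=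
    DifferentiableAt.inv (by fun_prop) h2.norm_inv_le.1
  have e3 : DifferentiableAt ℂ (fun p : ℂ × ℂ × ℂ => (1 + p.2.2)⁻¹) (u, v, w) :=
    DifferentiableAt.inv (by fun_prop) h3.norm_inv_le.1
  exact ((d1.mul d2).mul d3).mul ((e1.mul e2).mul e3)

end

theorem realOrSmall_pow_mul {V r x : ℝ} {N j : ℕ} (hx : 0 < x) (hxV : x ≤ V) (hj : j ≤ N) :
    RealOrSmall (V * 2 ^ N) r (2 ^ j * (x : ℂ)) := by
  refine Or.inl ⟨2 ^ j * x, by positivity, ?_, by push_cast; rfl⟩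
  rw [mul_comm]
  exact mul_le_mul hxV (pow_le_pow_right₀ one_le_two hj) (by positivity) (by linarith)

theorem one_add_pow_mul_exp_le (N : ℕ) : ∃ C : ℝ, 0 ≤ C ∧ ∀ x : ℝ, 0 ≤ x →
    (1 + x) ^ N * Real.exp (-x / 4) ≤ C * Real.exp (-x / 8) := by
  refine ⟨8 ^ N * N.factorial * Real.exp (1 / 8), by positivity, fun x hx => ?_⟩
  have h1 := Real.pow_div_factorial_le_exp ((1 + x) / 8) (by positivity) N
  rw [div_le_iff₀ (by positivity), div_pow, div_le_iff₀ (by positivity)] at h1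
  have h2 : Real.exp (-x / 4) * Real.exp ((1 + x) / 8) = Real.exp (1 / 8) * Real.exp (-x / 8) := by
    rw [← Real.exp_add, ← Real.exp_add]
    ring_nf
  calc _ ≤ Real.exp ((1 + x) / 8) * N.factorial * 8 ^ N * Real.exp (-x / 4) := by gcongr
    _ = 8 ^ N * N.factorial * (Real.exp (-x / 4) * Real.exp ((1 + x) / 8)) := by ring
    _ = _ := by rw [h2]; ring

/-- The iterated dyadic differences of `sectorFactor` in all three variables are small. -/
theorem norm_dyadicDiff_sectorFactor_le (N : ℕ) {V : ℝ} (hV : 1 ≤ V) : ∃ C : ℝ, 0 ≤ C ∧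
    ∀ x y z : ℝ, 0 < x → 0 < y → y ≤ V → 0 < z → z ≤ V →
    ‖dyadicDiff N (fun u => dyadicDiff N (fun v => dyadicDiff N (fun w => sectorFactor u v w) z) y)
      x‖ ≤ C * (x * y * z) ^ N * Real.exp (-x / 8) := by
  obtain ⟨C, hC, hpow⟩ := norm_dyadicDiff_le_pow N
  obtain ⟨C', hC', hbd⟩ := norm_dyadicDiff_le N
  obtain ⟨A, hA, hexp⟩ := one_add_pow_mul_exp_le N
  set V' : ℝ := V * 2 ^ N with hV'
  have hV1 : 1 ≤ V' := one_le_mul_of_one_le_of_one_le hV (one_le_pow₀ one_le_two)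
  set r := sectorRadius V' with hr
  have hr0 : 0 < r := sectorRadius_pos hV1
  have hr1 : r ≤ 1 / 8 := sectorRadius_le hV1
  have stepw : ∀ u v : ℂ, PosOrSmall r u → RealOrSmall V' (r / (1 + ‖u‖)) v → ∀ z : ℝ, 0 < z →
      z ≤ V → ‖dyadicDiff N (fun w => sectorFactor u v w) z‖ ≤
      C * (4096 * Real.exp (-‖u‖ / 4)) * (z / r) ^ N := by
    intro u v hu hv z hz hzV
    have := hpow (fun w => sectorFactor u v w) r (4096 * Real.exp (-‖u‖ / 4)) z hr0 ?_ ?_ ?_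
    · rwa [Complex.norm_real, Real.norm_of_nonneg hz.le] at this
    · intro w hw
      have hd : SectorDomain V' r u v w := ⟨hu, hv, Or.inr (by simpa using hw)⟩
      exact (DifferentiableAt.comp w (f := fun w => (u, v, w)) (hd.differentiableAt hV1)
        (by fun_prop)).differentiableWithinAt
    · intro w hw
      have hd : SectorDomain V' r u v w := ⟨hu, hv, Or.inr (by simpa using hw)⟩
      exact hd.norm_sectorFactor_le hV1
    · intro j hj
      have hd : SectorDomain V' r u v (2 ^ j * z) := ⟨hu, hv, realOrSmall_pow_mul hz hzV hj⟩
      exact hd.norm_sectorFactor_le hV1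
  have stepv : ∀ u : ℂ, PosOrSmall r u → ∀ y z : ℝ, 0 < y → y ≤ V → 0 < z → z ≤ V →
      ‖dyadicDiff N (fun v => dyadicDiff N (fun w => sectorFactor u v w) z) y‖ ≤
      C * C * 4096 * A * (1 / r) ^ N * (1 / r) ^ N * (y * z) ^ N * Real.exp (-‖u‖ / 8) := by
    intro u hu y z hy hyV hz hzV
    have hρ : 0 < r / (1 + ‖u‖) := by positivity
    have := hpow (fun v => dyadicDiff N (fun w => sectorFactor u v w) z) (r / (1 + ‖u‖))
      (C * (4096 * Real.exp (-‖u‖ / 4)) * (z / r) ^ N) y hρ ?_ ?_ ?_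
    · rw [Complex.norm_real, Real.norm_of_nonneg hy.le] at this
      refine this.trans ?_
      have h1 : (y / (r / (1 + ‖u‖))) ^ N = (1 + ‖u‖) ^ N * (1 / r) ^ N * y ^ N := by
        rw [← mul_pow, ← mul_pow]
        congr 1
        field_simp
      have h2 : (z / r) ^ N = (1 / r) ^ N * z ^ N := by
        rw [← mul_pow]
        congr 1
        ring
      rw [h1, h2, mul_pow y z]
      calc _ = C * C * 4096 * (1 / r) ^ N * (1 / r) ^ N * (y ^ N * z ^ N) *
            ((1 + ‖u‖) ^ N * Real.exp (-‖u‖ / 4)) := by ring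
        _ ≤ C * C * 4096 * (1 / r) ^ N * (1 / r) ^ N * (y ^ N * z ^ N) *
            (A * Real.exp (-‖u‖ / 8)) := by
          exact mul_le_mul_of_nonneg_left (hexp _ (norm_nonneg u)) (by positivity)
        _ = _ := by ring
    · intro v hv
      refine (differentiableAt_dyadicDiff fun j hj => ?_).differentiableWithinAt
      have hd : SectorDomain V' r u v (2 ^ j * z) :=
        ⟨hu, Or.inr (by simpa using hv), realOrSmall_pow_mul hz hzV hj⟩
      exact DifferentiableAt.comp v (f := fun v => (u, v, 2 ^ j * (z : ℂ)))
        (hd.differentiableAt hV1) (by fun_prop)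
    · intro v hv
      exact stepw u v hu (Or.inr (by simpa using hv)) z hz hzV
    · intro j hj
      exact stepw u _ hu (realOrSmall_pow_mul hy hyV hj) z hz hzV
  set B : ℝ := C * C * 4096 * A * (1 / r) ^ N * (1 / r) ^ N with hB
  have hB0 : 0 ≤ B := by positivity
  refine ⟨C * B * (1 / r) ^ N * Real.exp 1 + C' * B, by positivity,
    fun x y z hx hy hyV hz hzV => ?_⟩
  have hpos : ∀ j : ℕ, PosOrSmall r (2 ^ j * (x : ℂ)) := fun j =>
    Or.inl ⟨2 ^ j * x, by positivity, by push_cast; rfl⟩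
  have hreal : ∀ j : ℕ, ‖dyadicDiff N (fun v => dyadicDiff N
      (fun w => sectorFactor (2 ^ j * (x : ℂ)) v w) z) y‖ ≤
      B * (y * z) ^ N * Real.exp (-x / 8) := by
    intro j
    refine (stepv _ (hpos j) y z hy hyV hz hzV).trans ?_
    refine mul_le_mul_of_nonneg_left (Real.exp_le_exp.2 ?_) (by positivity)
    rw [norm_mul, norm_pow, Complex.norm_ofNat, Complex.norm_real, Real.norm_of_nonneg hx.le]
    have : 1 ≤ (2 : ℝ) ^ j := one_le_pow₀ one_le_two
    nlinarith
  rcases le_total x 1 with hx1 | hx1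
  · have hE : 1 ≤ Real.exp 1 * Real.exp (-x / 8) := by
      rw [← Real.exp_add]
      exact Real.one_le_exp (by linarith)
    have := hpow (fun u => dyadicDiff N (fun v => dyadicDiff N (fun w => sectorFactor u v w) z) y)
      r (B * (y * z) ^ N) x hr0 ?_ ?_ ?_
    · rw [Complex.norm_real, Real.norm_of_nonneg hx.le] at this
      refine this.trans ?_
      have h1 : (x / r) ^ N = (1 / r) ^ N * x ^ N := by
        rw [← mul_pow]
        congr 1
        ring
      calc _ = C * B * (1 / r) ^ N * (x * y * z) ^ N * 1 := by
            rw [h1, mul_assoc x y z, mul_pow x]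
            ring
        _ ≤ C * B * (1 / r) ^ N * (x * y * z) ^ N * (Real.exp 1 * Real.exp (-x / 8)) := by
          gcongr
        _ = C * B * (1 / r) ^ N * Real.exp 1 * (x * y * z) ^ N * Real.exp (-x / 8) := by ring
        _ ≤ _ := by
          gcongr
          have : 0 ≤ C' * B := by positivity
          linarith
    · intro u hu
      have hu' : ‖u‖ < r := by simpa using hu
      refine (differentiableAt_dyadicDiff (h := fun u v =>
        dyadicDiff N (fun w => sectorFactor u v w) z) fun i hi => ?_).differentiableWithinAt
      refine differentiableAt_dyadicDiff (h := fun u w => sectorFactor u (2 ^ i * (y : ℂ)) w)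
        fun j hj => ?_
      have hd : SectorDomain V' r u (2 ^ i * y) (2 ^ j * z) :=
        ⟨Or.inr hu', realOrSmall_pow_mul hy hyV hi, realOrSmall_pow_mul hz hzV hj⟩
      exact DifferentiableAt.comp u (f := fun u => (u, 2 ^ i * (y : ℂ), 2 ^ j * (z : ℂ)))
        (hd.differentiableAt hV1) (by fun_prop)
    · intro u hu
      refine (stepv u (Or.inr (by simpa using hu)) y z hy hyV hz hzV).trans ?_
      refine mul_le_of_le_one_right (by positivity) (Real.exp_le_one_iff.2 ?_)
      linarith [norm_nonneg u]
    · intro j _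
      refine (hreal j).trans ?_
      exact mul_le_of_le_one_right (by positivity) (Real.exp_le_one_iff.2 (by linarith))
  · refine (hbd _ x _ fun j _ => hreal j).trans ?_
    have h1 : (y * z) ^ N ≤ (x * y * z) ^ N := by
      refine pow_le_pow_left₀ (by positivity) ?_ _
      rw [mul_assoc]
      exact le_mul_of_one_le_left (by positivity) hx1
    calc _ ≤ C' * (B * (x * y * z) ^ N * Real.exp (-x / 8)) := by gcongr
      _ = C' * B * (x * y * z) ^ N * Real.exp (-x / 8) := by ring
      _ ≤ _ := by
        gcongr
        have : 0 ≤ C * B * (1 / r) ^ N * Real.exp 1 := by positivity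
        linarith

end

section

open MvPolynomial

section Dilate

variable {n : ℕ} (p q : MvPolynomial (Fin n) ℂ) (F : (Fin n → ℝ) → ℂ) (t : Fin n → ℝ)

theorem dilate_eq_constr : dilate p F t =
    (basisMonomials (Fin n) ℂ).constr ℂ (fun m => F ((fun i => (2 : ℝ) ^ m i) * t)) p := by
  rw [Module.Basis.constr_apply]
  rfl

theorem dilate_add : dilate (p + q) F t = dilate p F t + dilate q F t := by
  simp only [dilate_eq_constr, map_add]

theorem dilate_sub : dilate (p - q) F t = dilate p F t - dilate q F t := by
  simp only [dilate_eq_constr, map_sub]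

theorem dilate_monomial (m : Fin n →₀ ℕ) (a : ℂ) :
    dilate (monomial m a) F t = a * F ((fun i => (2 : ℝ) ^ m i) * t) := by
  have h : monomial m a = a • basisMonomials (Fin n) ℂ m := by
    simp [smul_monomial]
  rw [dilate_eq_constr, h, map_smul, Module.Basis.constr_basis, smul_eq_mul]

theorem dilate_C (a : ℂ) : dilate (C a) F t = a * F t := by
  have h := dilate_monomial F t 0 a
  rw [monomial_zero'] at h
  rw [h]
  congr 2
  ext i
  simp

theorem dilate_mul : dilate (p * q) F t = dilate p (dilate q F) t := by
  induction p using MvPolynomial.induction_on' with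
  | add p₁ p₂ h₁ h₂ => rw [add_mul, dilate_add, dilate_add, h₁, h₂]
  | monomial m a =>
    induction q using MvPolynomial.induction_on' with
    | add q₁ q₂ h₁ h₂ =>
      rw [mul_add, dilate_add, h₁, h₂, dilate_monomial, dilate_monomial, dilate_monomial,
        dilate_add, mul_add]
    | monomial m' a' =>
      rw [monomial_mul, dilate_monomial, dilate_monomial, dilate_monomial, mul_assoc]
      congr 3
      ext i
      simp [pow_add]
      ring

end Dilate

/-- The operator that subtracts from `F` its homogeneous components of degrees
`-d, …, N - 1 - d` under scaling of the coordinates in `I`. -/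
noncomputable def stepPoly {n : ℕ} (I : Finset (Fin n)) (d N : ℕ) : MvPolynomial (Fin n) ℂ :=
  ∏ k ∈ Finset.range N, (monomial (∑ i ∈ I, Finsupp.single i 1) 1 - C ((2 : ℂ) ^ k / 2 ^ d))

theorem sum_single_apply {n : ℕ} (I : Finset (Fin n)) (j : Fin n) :
    (∑ i ∈ I, Finsupp.single i 1 : Fin n →₀ ℕ) j = if j ∈ I then 1 else 0 := by
  rw [Finsupp.finsetSum_apply]
  simp [Finsupp.single_apply]

theorem eval_stepPoly {n : ℕ} (I : Finset (Fin n)) (d N : ℕ) (x : Fin n → ℂ) :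
    eval x (stepPoly I d N) = ∏ k ∈ Finset.range N, (∏ i ∈ I, x i - 2 ^ k / 2 ^ d) := by
  rw [stepPoly, map_prod]
  refine Finset.prod_congr rfl fun k _ => ?_
  rw [map_sub, eval_C, eval_monomial, one_mul, Finsupp.prod_fintype _ _ fun i => pow_zero _]
  congr 1
  simp only [sum_single_apply]
  rw [← Finset.prod_filter_mul_prod_filter_not Finset.univ (· ∈ I)]
  rw [Finset.prod_congr (g := fun i => x i) rfl (fun i hi => by simp [(Finset.mem_filter.1 hi).2]),
    Finset.prod_congr (g := fun _ => (1 : ℂ)) (s₁ := Finset.univ.filter (¬ · ∈ I)) rfl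
      (fun i hi => by simp [(Finset.mem_filter.1 hi).2])]
  simp

theorem dilate_stepPoly {n : ℕ} {I : Finset (Fin n)} {d : ℕ} {F : (Fin n → ℝ) → ℂ}
    {τ : ℝ → Fin n → ℝ} {χ : ℂ → ℂ} {κ : ℂ}
    (hτ : ∀ x i, τ (2 * x) i = (if i ∈ I then 2 else 1) * τ x i)
    (hF : ∀ x : ℝ, F (τ x) = κ * (x : ℂ)⁻¹ ^ d * χ x) (N : ℕ) (x : ℝ) :
    dilate (stepPoly I d N) F (τ x) =
      κ * ((2 ^ d)⁻¹) ^ N * (x : ℂ)⁻¹ ^ d * dyadicDiff N χ x := by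
  induction N generalizing x with
  | zero =>
    rw [stepPoly, Finset.prod_range_zero, ← C_1, dilate_C, hF, dyadicDiff]
    ring
  | succ N ih =>
    have h1 : (fun i => (2 : ℝ) ^ (∑ i ∈ I, Finsupp.single i 1 : Fin n →₀ ℕ) i) * τ x =
        τ (2 * x) := by
      ext i
      rw [hτ, Pi.mul_apply, sum_single_apply]
      split_ifs <;> simp
    rw [stepPoly, Finset.prod_range_succ, mul_comm, dilate_mul, dilate_sub, dilate_monomial,
      dilate_C, h1, ← stepPoly, ih, ih, dyadicDiff]
    push_cast
    rw [mul_inv, mul_pow, inv_pow (2 : ℂ) d]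
    ring

theorem pairBose_comp_perm (σ : Equiv.Perm (Fin 3)) (t : Fin 3 → ℝ) :
    pairBose (fun i => t (σ i)) = pairBose t := by
  have h : ∀ t : Fin 3 → ℝ, pairBose t = ∏ i, bose ((∑ j, (t j : ℂ)) - t i) := by
    intro t
    rw [Fin.prod_univ_three, Fin.sum_univ_three, pairBose]
    rw [show (t 0 : ℂ) + t 1 + t 2 - t 0 = t 1 + t 2 by ring,
      show (t 0 : ℂ) + t 1 + t 2 - t 1 = t 2 + t 0 by ring,
      show (t 0 : ℂ) + t 1 + t 2 - t 2 = t 0 + t 1 by ring]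
    ring
  rw [h, h, Equiv.sum_comp σ fun j => (t j : ℂ)]
  exact Equiv.prod_comp σ fun i => bose ((∑ j, (t j : ℂ)) - t i)

/-- Coordinates on the sector `t (σ 2) ≤ t (σ 1) ≤ t (σ 0)`. -/
def sectorMap (σ : Equiv.Perm (Fin 3)) (u v w : ℝ) : Fin 3 → ℝ :=
  fun i => ![u, u * v, u * v * w] (σ.symm i)

theorem pairBose_sectorMap (σ : Equiv.Perm (Fin 3)) (u v w : ℝ) : pairBose (sectorMap σ u v w) =
    (u : ℂ)⁻¹ ^ 3 * (v : ℂ)⁻¹ * sectorFactor u v w := by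
  have h1 : pairBose (sectorMap σ u v w) = pairBose ![u, u * v, u * v * w] :=
    pairBose_comp_perm σ.symm ![u, u * v, u * v * w]
  have h2 : pairBose ![u, u * v, u * v * w] =
      bose (u * (1 + v)) * bose (u * v * (1 + w)) * bose (u * (1 + v * w)) := by
    simp only [pairBose, Matrix.cons_val_zero, Matrix.cons_val_one, Matrix.cons_val]
    push_cast
    congr 2
    · congr 1
      ring
    · congr 1
      ring
    · ring
  rw [h1, h2, bose_eq_todd_div, bose_eq_todd_div (u * v * (1 + w)),
    bose_eq_todd_div (u * (1 + v * w)), sectorFactor]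
  simp only [mul_inv]
  ring

/-- The operator adapted to the sector `t (σ 2) ≤ t (σ 1) ≤ t (σ 0)`. -/
noncomputable def sectorPoly (σ : Equiv.Perm (Fin 3)) (N : ℕ) : MvPolynomial (Fin 3) ℂ :=
  stepPoly Finset.univ 3 N * (stepPoly {σ 1, σ 2} 1 N * stepPoly {σ 2} 0 N)

theorem dilate_sectorPoly (σ : Equiv.Perm (Fin 3)) (N : ℕ) (u v w : ℝ) :
    dilate (sectorPoly σ N) pairBose (sectorMap σ u v w) =
      ((2 ^ 1)⁻¹) ^ N * ((2 ^ 3)⁻¹) ^ N * (v : ℂ)⁻¹ * (u : ℂ)⁻¹ ^ 3 *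
      dyadicDiff N (fun u => dyadicDiff N (fun v => dyadicDiff N (fun w => sectorFactor u v w) w)
        v) u := by
  have h12 : σ 1 ≠ σ 2 := σ.injective.ne (by decide)
  have h01 : σ 0 ≠ σ 1 := σ.injective.ne (by decide)
  have h02 : σ 0 ≠ σ 2 := σ.injective.ne (by decide)
  have hi : ∀ i, i = σ 0 ∨ i = σ 1 ∨ i = σ 2 := by
    intro i
    obtain ⟨j, rfl⟩ := σ.surjective i
    fin_cases j <;> simp
  have hw : ∀ u v w : ℝ, dilate (stepPoly {σ 2} 0 N) pairBose (sectorMap σ u v w) =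
      (u : ℂ)⁻¹ ^ 3 * (v : ℂ)⁻¹ * dyadicDiff N (fun w => sectorFactor u v w) w := by
    intro u v w
    rw [dilate_stepPoly (τ := fun w => sectorMap σ u v w) (κ := (u : ℂ)⁻¹ ^ 3 * (v : ℂ)⁻¹)
      (χ := fun w => sectorFactor u v w)]
    · simp
    · intro x i
      rcases hi i with rfl | rfl | rfl
      · simp [sectorMap, h02]
      · simp [sectorMap, h12]
      · simp [sectorMap]
        ring
    · intro x
      rw [pairBose_sectorMap, pow_zero, mul_one]
  have hv : ∀ u v w : ℝ, dilate (stepPoly {σ 1, σ 2} 1 N) (dilate (stepPoly {σ 2} 0 N) pairBose)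
      (sectorMap σ u v w) = (u : ℂ)⁻¹ ^ 3 * ((2 ^ 1)⁻¹) ^ N * (v : ℂ)⁻¹ ^ 1 *
      dyadicDiff N (fun v => dyadicDiff N (fun w => sectorFactor u v w) w) v := by
    intro u v w
    refine dilate_stepPoly (τ := fun v => sectorMap σ u v w) (κ := (u : ℂ)⁻¹ ^ 3)
      (χ := fun v => dyadicDiff N (fun w => sectorFactor u v w) w) ?_ ?_ N v
    · intro x i
      rcases hi i with rfl | rfl | rfl
      · simp [sectorMap, h01, h02]
      · simp [sectorMap]
        ring
      · simp [sectorMap]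
        ring
    · intro x
      rw [hw, pow_one]
  rw [sectorPoly, dilate_mul]
  rw [dilate_stepPoly (τ := fun u => sectorMap σ u v w) (κ := ((2 ^ 1)⁻¹) ^ N * (v : ℂ)⁻¹)
    (χ := fun u => dyadicDiff N (fun v => dyadicDiff N (fun w => sectorFactor u v w) w) v)]
  · ring
  · intro x i
    rcases hi i with rfl | rfl | rfl <;> simp [sectorMap, mul_assoc]
  · intro x
    rw [show dilate (stepPoly {σ 1, σ 2} 1 N * stepPoly {σ 2} 0 N) pairBose =
      dilate (stepPoly {σ 1, σ 2} 1 N) (dilate (stepPoly {σ 2} 0 N) pairBose) from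
      funext fun t => dilate_mul _ _ _ _, hv]
    ring

theorem norm_dilate_sectorPoly_le (K : ℕ) {V : ℝ} (hV : 1 ≤ V) : ∃ C : ℝ, 0 ≤ C ∧
    ∀ (σ : Equiv.Perm (Fin 3)) (t : Fin 3 → ℝ), t ∈ octant 3 → t (σ 1) ≤ V * t (σ 0) →
    t (σ 2) ≤ V * t (σ 1) → ‖dilate (sectorPoly σ (3 * K + 3)) pairBose t‖ ≤
      C * ∏ i, (t i ^ K * Real.exp (-(8 * (1 + V + V ^ 2))⁻¹ * t i)) := by
  obtain ⟨C, hC, h⟩ := norm_dyadicDiff_sectorFactor_le (3 * K + 3) hV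
  refine ⟨C * V ^ 5 * V ^ (3 * K), by positivity, fun σ t ht h1 h2 => ?_⟩
  have hpos := mem_octant.1 ht
  set u := t (σ 0) with hu
  set v := t (σ 1) / t (σ 0) with hv
  set w := t (σ 2) / t (σ 1) with hw
  have hu0 : 0 < u := hpos _
  have hv0 : 0 < v := div_pos (hpos _) (hpos _)
  have hw0 : 0 < w := div_pos (hpos _) (hpos _)
  have hvV : v ≤ V := (div_le_iff₀ (hpos _)).2 h1
  have hwV : w ≤ V := (div_le_iff₀ (hpos _)).2 h2
  have e1 : t (σ 1) = u * v := by rw [hu, hv, mul_div_cancel₀ _ (hpos _).ne']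
  have e2 : t (σ 2) = u * v * w := by rw [← e1, hw, mul_div_cancel₀ _ (hpos _).ne']
  have ht' : t = sectorMap σ u v w := by
    ext i
    obtain ⟨j, rfl⟩ := σ.surjective i
    fin_cases j
    · simp [sectorMap, hu]
    · simpa [sectorMap] using e1
    · simpa [sectorMap] using e2
  have hprod : ∀ ε : ℝ, ∏ i, (t i ^ K * Real.exp (ε * t i)) =
      (u * (u * v) * (u * v * w)) ^ K * Real.exp (ε * (u + u * v + u * v * w)) := by
    intro ε
    rw [← Equiv.prod_comp σ, Fin.prod_univ_three, ← hu, e1, e2, mul_pow, mul_pow, mul_add, mul_add,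
      Real.exp_add, Real.exp_add]
    ring
  rw [hprod]
  conv_lhs => rw [ht']
  rw [dilate_sectorPoly, norm_mul, norm_mul, norm_mul, norm_mul, norm_pow, norm_pow, norm_pow,
    norm_inv, norm_inv, norm_inv, norm_inv, norm_pow, norm_pow, Complex.norm_ofNat,
    Complex.norm_real, Complex.norm_real, Real.norm_of_nonneg hv0.le, Real.norm_of_nonneg hu0.le]
  have hexp : Real.exp (-u / 8) ≤
      Real.exp (-(8 * (1 + V + V ^ 2))⁻¹ * (u + u * v + u * v * w)) := by
    refine Real.exp_le_exp.2 ?_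
    have h3 : u + u * v + u * v * w ≤ (1 + V + V ^ 2) * u := by
      have : v * w ≤ V * V := mul_le_mul hvV hwV hw0.le (by linarith)
      nlinarith
    have h4 : 0 < 1 + V + V ^ 2 := by positivity
    rw [neg_mul, neg_div, neg_le_neg_iff, inv_mul_le_iff₀ (by positivity)]
    linarith
  have hc1 : ((2 : ℝ) ^ 1)⁻¹ ^ (3 * K + 3) ≤ 1 := pow_le_one₀ (by norm_num) (by norm_num)
  have hc2 : ((2 : ℝ) ^ 3)⁻¹ ^ (3 * K + 3) ≤ 1 := pow_le_one₀ (by norm_num) (by norm_num)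
  calc _ ≤ 1 * 1 * v⁻¹ * u⁻¹ ^ 3 * (C * (u * v * w) ^ (3 * K + 3) * Real.exp (-u / 8)) := by
        gcongr
        exact h u v w hu0 hv0 hvV hw0 hwV
    _ = C * (v ^ 2 * w ^ 3) * ((v * w ^ 2) ^ K) * ((u * (u * v) * (u * v * w)) ^ K *
          Real.exp (-u / 8)) := by
        have h5 : (u * v * w) ^ (3 * K + 3) =
            (v * w ^ 2) ^ K * (u * (u * v) * (u * v * w)) ^ K * (u * v * w) ^ 3 := by
          rw [pow_add, pow_mul, ← mul_pow]
          ring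
        rw [h5]
        field_simp
    _ ≤ C * (V ^ 2 * V ^ 3) * ((V * V ^ 2) ^ K) * ((u * (u * v) * (u * v * w)) ^ K *
          Real.exp (-(8 * (1 + V + V ^ 2))⁻¹ * (u + u * v + u * v * w))) := by
        gcongr
    _ = _ := by
        rw [pow_mul]
        ring

/-- The operator removing the singular part of `pairBose` along all coordinate subspaces. -/
noncomputable def fullPoly (N : ℕ) : MvPolynomial (Fin 3) ℂ :=
  ∏ I : Finset (Fin 3) with I.Nonempty, stepPoly I (I.card.choose 2) N

theorem exists_fullPoly_eq_mul_sectorPoly (σ : Equiv.Perm (Fin 3)) (N : ℕ) :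
    ∃ q, fullPoly N = q * sectorPoly σ N := by
  have h12 : σ 1 ≠ σ 2 := σ.injective.ne (by decide)
  have hc1 : ({σ 2} : Finset (Fin 3)).card = 1 := Finset.card_singleton _
  have hc2 : ({σ 1, σ 2} : Finset (Fin 3)).card = 2 := Finset.card_pair h12
  have hc3 : (Finset.univ : Finset (Fin 3)).card = 3 := by simp
  have hn1 : (Finset.univ : Finset (Fin 3)) ∉
      ({{σ 1, σ 2}, {σ 2}} : Finset (Finset (Fin 3))) := by
    intro h
    rw [Finset.mem_insert, Finset.mem_singleton] at h
    rcases h with h | h <;> rw [h] at hc3 <;> omega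
  have hn2 : ({σ 1, σ 2} : Finset (Fin 3)) ∉ ({{σ 2}} : Finset (Finset (Fin 3))) := by
    intro h
    rw [Finset.mem_singleton] at h
    rw [h] at hc2
    omega
  have hsub : ({Finset.univ, {σ 1, σ 2}, {σ 2}} : Finset (Finset (Fin 3))) ⊆
      Finset.univ.filter Finset.Nonempty := by
    intro I hI
    simp only [Finset.mem_insert, Finset.mem_singleton] at hI
    rw [Finset.mem_filter]
    refine ⟨Finset.mem_univ _, ?_⟩
    rcases hI with rfl | rfl | rfl
    · exact Finset.univ_nonempty
    · exact Finset.insert_nonempty _ _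
    · exact Finset.singleton_nonempty _
  refine ⟨_, (Finset.prod_sdiff hsub).symm.trans (congrArg _ ?_)⟩
  rw [Finset.prod_insert hn1, Finset.prod_insert hn2, Finset.prod_singleton, hc1, hc2, hc3]
  rfl

theorem exists_perm_antitone (t : Fin 3 → ℝ) :
    ∃ σ : Equiv.Perm (Fin 3), t (σ 1) ≤ t (σ 0) ∧ t (σ 2) ≤ t (σ 1) := by
  have h := Tuple.monotone_sort fun i => -t i
  refine ⟨Tuple.sort fun i => -t i, ?_, ?_⟩
  · exact neg_le_neg_iff.1 (h (show (0 : Fin 3) ≤ 1 by decide))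
  · exact neg_le_neg_iff.1 (h (show (1 : Fin 3) ≤ 2 by decide))

theorem norm_dilate_fullPoly_le (K : ℕ) : ∃ C ε : ℝ, 0 < ε ∧ ∀ t ∈ octant 3,
    ‖dilate (fullPoly (3 * K + 3)) pairBose t‖ ≤
      C * ∏ i, (t i ^ K * Real.exp (-ε * t i)) := by
  choose q hq using fun σ => exists_fullPoly_eq_mul_sectorPoly σ (3 * K + 3)
  let M := Finset.univ.sup fun σ => (q σ).totalDegree
  have hM : ∀ σ, ∀ m ∈ (q σ).support, ∀ i, m i ≤ M := by
    intro σ m hm i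
    refine le_trans ?_ (Finset.le_sup (f := fun σ => (q σ).totalDegree) (Finset.mem_univ σ))
    refine le_trans ?_ (le_totalDegree hm)
    rw [Finsupp.sum_fintype _ _ fun _ => rfl]
    exact Finset.single_le_sum (f := fun i => m i) (fun _ _ => Nat.zero_le _) (Finset.mem_univ i)
  have hV : 1 ≤ (2 : ℝ) ^ M := one_le_pow₀ one_le_two
  obtain ⟨C, hC, h⟩ := norm_dilate_sectorPoly_le K hV
  set V : ℝ := 2 ^ M with hVdef
  set ε := (8 * (1 + V + V ^ 2))⁻¹ with hε
  have hε0 : 0 < ε := by positivity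
  refine ⟨∑ σ, ∑ m ∈ (q σ).support, ‖(q σ).coeff m‖ * (C * (V ^ K) ^ 3), ε, hε0,
    fun t ht => ?_⟩
  have hpos := mem_octant.1 ht
  obtain ⟨σ, h1, h2⟩ := exists_perm_antitone t
  have hterm : ∀ m ∈ (q σ).support,
      ‖dilate (sectorPoly σ (3 * K + 3)) pairBose ((fun i => (2 : ℝ) ^ m i) * t)‖ ≤
      C * (V ^ K) ^ 3 * ∏ i, (t i ^ K * Real.exp (-ε * t i)) := by
    intro m hm
    have hle : ∀ i, (2 : ℝ) ^ m i ≤ V := fun i => pow_le_pow_right₀ one_le_two (hM σ m hm i)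
    have hge : ∀ i, 1 ≤ (2 : ℝ) ^ m i := fun i => one_le_pow₀ one_le_two
    have hratio : ∀ i j, t i ≤ t j → (2 : ℝ) ^ m i * t i ≤ V * (2 ^ m j * t j) := by
      intro i j hij
      refine mul_le_mul (hle i) (hij.trans ?_) (hpos i).le (by positivity)
      exact le_mul_of_one_le_left (hpos j).le (hge j)
    refine (h σ _ (mem_octant.2 fun i => mul_pos (by positivity) (hpos i)) (hratio _ _ h1)
      (hratio _ _ h2)).trans ?_
    rw [mul_assoc C]
    refine mul_le_mul_of_nonneg_left ?_ hC
    have h3 : (V ^ K) ^ 3 = ∏ _i : Fin 3, V ^ K := by simp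
    rw [h3, ← Finset.prod_mul_distrib]
    refine Finset.prod_le_prod (fun i _ => ?_) fun i _ => ?_
    · exact mul_nonneg (pow_nonneg (mul_nonneg (by positivity) (hpos i).le) _) (Real.exp_nonneg _)
    · rw [← mul_assoc (V ^ K)]
      refine mul_le_mul ?_ (Real.exp_le_exp.2 ?_) (Real.exp_nonneg _)
        (mul_nonneg (by positivity) (pow_nonneg (hpos i).le _))
      · rw [mul_pow]
        exact mul_le_mul_of_nonneg_right (pow_le_pow_left₀ (by positivity) (hle i) _)
          (pow_nonneg (hpos i).le _)
      · rw [neg_mul, neg_mul, neg_le_neg_iff]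
        exact mul_le_mul_of_nonneg_left (le_mul_of_one_le_left (hpos i).le (hge i)) hε0.le
  rw [hq σ, dilate_mul, dilate]
  have hP : 0 ≤ ∏ i, (t i ^ K * Real.exp (-ε * t i)) :=
    Finset.prod_nonneg fun i _ => mul_nonneg (pow_nonneg (hpos i).le _) (Real.exp_nonneg _)
  calc _ ≤ ∑ m ∈ (q σ).support, ‖(q σ).coeff m‖ * (C * (V ^ K) ^ 3 *
          ∏ i, (t i ^ K * Real.exp (-ε * t i))) := by
        refine (norm_sum_le _ _).trans (Finset.sum_le_sum fun m hm => ?_)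
        rw [norm_mul]
        exact mul_le_mul_of_nonneg_left (hterm m hm) (norm_nonneg _)
    _ = (∑ m ∈ (q σ).support, ‖(q σ).coeff m‖ * (C * (V ^ K) ^ 3)) *
          ∏ i, (t i ^ K * Real.exp (-ε * t i)) := by
        rw [Finset.sum_mul]
        exact Finset.sum_congr rfl fun m _ => by ring
    _ ≤ _ := by
        refine mul_le_mul_of_nonneg_right ?_ hP
        exact Finset.single_le_sum (f := fun σ =>
          ∑ m ∈ (q σ).support, ‖(q σ).coeff m‖ * (C * (V ^ K) ^ 3))
          (fun σ _ => Finset.sum_nonneg fun m _ => by positivity) (Finset.mem_univ σ)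

theorem measurable_dilate {n : ℕ} {F : (Fin n → ℝ) → ℂ} (hF : Measurable F)
    (p : MvPolynomial (Fin n) ℂ) : Measurable (dilate p F) := by
  unfold dilate
  refine Finset.measurable_fun_sum _ fun m _ => Measurable.const_mul (hF.comp ?_) _
  fun_prop

end

section

open MeasureTheory

theorem lintegral_Ioi_of_hasDerivAt_of_nonneg {g g' : ℝ → ℝ} {a l : ℝ}
    (hcont : ContinuousWithinAt g (Set.Ici a) a) (hderiv : ∀ x ∈ Set.Ioi a, HasDerivAt g (g' x) x)
    (hpos : ∀ x ∈ Set.Ioi a, 0 ≤ g' x) (hg : Tendsto g atTop (𝓝 l)) :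
    ∫⁻ x in Set.Ioi a, ENNReal.ofReal (g' x) = ENNReal.ofReal (l - g a) := by
  rw [← integral_Ioi_of_hasDerivAt_of_nonneg hcont hderiv hpos hg,
    ofReal_integral_eq_lintegral_ofReal (integrableOn_Ioi_deriv_of_nonneg hcont hderiv hpos hg)]
  exact (ae_restrict_iff' measurableSet_Ioi).2 (Eventually.of_forall hpos)

theorem lintegral_inv_one_add_mul_add {x : ℝ} (hx : 0 < x) (hx1 : x ≠ 1) :
    ∫⁻ y in Set.Ioi 0, ENNReal.ofReal ((1 + y) * (x + y))⁻¹ =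
      ENNReal.ofReal (Real.log x / (x - 1)) := by
  have hx1' : x - 1 ≠ 0 := sub_ne_zero.2 hx1
  have hd : ∀ y, 0 ≤ y → HasDerivAt (fun y => (Real.log (1 + y) - Real.log (x + y)) / (x - 1))
      ((1 + y) * (x + y))⁻¹ y := by
    intro y hy
    have h1 : (1 + y) ≠ 0 := by linarith
    have h2 : (x + y) ≠ 0 := by linarith
    have h3 := ((((hasDerivAt_id y).const_add 1).log h1).sub
      (((hasDerivAt_id y).const_add x).log h2)).div_const (x - 1)
    refine h3.congr_deriv ?_
    simp only [id]
    field_simp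
    ring
  rw [lintegral_Ioi_of_hasDerivAt_of_nonneg (l := 0)
    (hd 0 le_rfl).continuousAt.continuousWithinAt (fun y hy => hd y (le_of_lt hy))]
  · congr 1
    simp
    ring
  · intro y hy
    have hy' : 0 < y := hy
    positivity
  · have h1 : Tendsto (fun y : ℝ => 1 + (1 - x) / (x + y)) atTop (𝓝 (1 + 0)) :=
      (tendsto_const_nhds.div_atTop (tendsto_atTop_add_const_left _ _ tendsto_id)).const_add 1
    rw [add_zero] at h1
    have h2 := ((Real.continuousAt_log one_ne_zero).tendsto.comp h1).div_const (x - 1)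
    rw [Real.log_one, zero_div] at h2
    refine h2.congr' ?_
    filter_upwards [eventually_gt_atTop 0] with y hy
    have h3 : (x + y) ≠ 0 := by linarith
    rw [← Real.log_div (by linarith) h3, Function.comp_apply]
    congr 2
    field_simp
    ring

theorem lintegral_inv_sq_add {y : ℝ} (hy : 0 < y) :
    ∫⁻ x in Set.Ioi 0, ENNReal.ofReal (x ^ 2 + y)⁻¹ =
      ENNReal.ofReal (Real.pi / 2 * (√y)⁻¹) := by
  have hs : 0 < √y := Real.sqrt_pos.2 hy
  have hd : ∀ x, HasDerivAt (fun x => Real.arctan (x / √y) * (√y)⁻¹) (x ^ 2 + y)⁻¹ x := by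
    intro x
    have h := ((hasDerivAt_id x).div_const √y).arctan.mul_const (√y)⁻¹
    refine h.congr_deriv ?_
    simp only [id]
    rw [div_pow, Real.sq_sqrt hy.le]
    have h1 : √y * √y = y := Real.mul_self_sqrt hy.le
    have h2 : y + x ^ 2 ≠ 0 := by positivity
    have h3 : x ^ 2 + y ≠ 0 := by positivity
    calc _ = (1 + x ^ 2 / y)⁻¹ * (√y * √y)⁻¹ := by rw [mul_inv]; ring
      _ = _ := by
        rw [h1, ← mul_inv]
        congr 1
        field_simp
        ring
  rw [lintegral_Ioi_of_hasDerivAt_of_nonneg (l := Real.pi / 2 * (√y)⁻¹)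
    (hd 0).continuousAt.continuousWithinAt (fun x _ => hd x)]
  · simp
  · intro x _
    positivity
  · refine Tendsto.mul_const _ ?_
    exact (Real.tendsto_arctan_atTop.mono_right nhdsWithin_le_nhds).comp
      (tendsto_id.atTop_div_const hs)

theorem lintegral_inv_one_add_mul_inv_sqrt :
    ∫⁻ y in Set.Ioi 0, ENNReal.ofReal ((1 + y)⁻¹ * (√y)⁻¹) = ENNReal.ofReal Real.pi := by
  rw [lintegral_Ioi_of_hasDerivAt_of_nonneg (l := Real.pi)
    (g := fun y => 2 * Real.arctan √y) (by fun_prop)]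
  · simp
  · intro y hy
    have hy' : (0 : ℝ) < y := hy
    have h := ((Real.hasDerivAt_sqrt hy'.ne').arctan).const_mul 2
    refine h.congr_deriv ?_
    rw [Real.sq_sqrt hy'.le]
    have : 0 < √y := Real.sqrt_pos.2 hy'
    field_simp
  · intro y hy
    have hy' : (0 : ℝ) < y := hy
    positivity
  · have h := ((Real.tendsto_arctan_atTop.mono_right nhdsWithin_le_nhds).comp
      Real.tendsto_sqrt_atTop).const_mul 2
    rwa [mul_div_cancel₀ _ two_ne_zero] at h

theorem lintegral_lintegral_inv_pairs :
    ∫⁻ x in Set.Ioi (0 : ℝ), ∫⁻ y in Set.Ioi (0 : ℝ),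
      ENNReal.ofReal ((1 + x) * (1 + y) * (x + y))⁻¹ = ENNReal.ofReal (Real.pi ^ 2 / 4) := by
  have h1 : ∀ᵐ x ∂(volume.restrict (Set.Ioi (0 : ℝ))), ∫⁻ y in Set.Ioi (0 : ℝ),
      ENNReal.ofReal ((1 + x) * (1 + y) * (x + y))⁻¹ = ∫⁻ y in Set.Ioi (0 : ℝ),
      ENNReal.ofReal (1 / 2) * ENNReal.ofReal ((1 + y) * (x ^ 2 + y))⁻¹ := by
    refine (ae_restrict_iff' measurableSet_Ioi).2 ?_
    filter_upwards [Measure.ae_ne volume (1 : ℝ)] with x hx1 hx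
    have hx' : (0 : ℝ) < x := hx
    have hsq : x ^ 2 ≠ 1 := by
      intro h
      exact hx1 (by nlinarith)
    have h2 : ∀ y, ENNReal.ofReal ((1 + x) * (1 + y) * (x + y))⁻¹ =
        ENNReal.ofReal (1 + x)⁻¹ * ENNReal.ofReal ((1 + y) * (x + y))⁻¹ := by
      intro y
      rw [← ENNReal.ofReal_mul (by positivity), mul_assoc, mul_inv]
    simp only [h2]
    rw [lintegral_const_mul' _ _ ENNReal.ofReal_ne_top,
      lintegral_const_mul' _ _ ENNReal.ofReal_ne_top, lintegral_inv_one_add_mul_add hx' hx1,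
      lintegral_inv_one_add_mul_add (by positivity) hsq, ← ENNReal.ofReal_mul (by positivity),
      ← ENNReal.ofReal_mul (by positivity)]
    congr 1
    rw [Real.log_pow, show x ^ 2 - 1 = (1 + x) * (x - 1) by ring]
    have h3 : 1 + x ≠ 0 := by linarith
    have h4 : x - 1 ≠ 0 := sub_ne_zero.2 hx1
    field_simp
    norm_num
  rw [lintegral_congr_ae h1, lintegral_lintegral_swap]
  · have h2 : ∀ y ∈ Set.Ioi (0 : ℝ), ∫⁻ x in Set.Ioi (0 : ℝ),
        ENNReal.ofReal (1 / 2) * ENNReal.ofReal ((1 + y) * (x ^ 2 + y))⁻¹ =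
        ENNReal.ofReal (Real.pi / 4) * ENNReal.ofReal ((1 + y)⁻¹ * (√y)⁻¹) := by
      intro y hy
      have hy' : (0 : ℝ) < y := hy
      have h3 : ∀ x : ℝ, ENNReal.ofReal ((1 + y) * (x ^ 2 + y))⁻¹ =
          ENNReal.ofReal (1 + y)⁻¹ * ENNReal.ofReal (x ^ 2 + y)⁻¹ := by
        intro x
        rw [← ENNReal.ofReal_mul (by positivity), mul_inv]
      simp only [h3]
      rw [lintegral_const_mul' _ _ ENNReal.ofReal_ne_top,
        lintegral_const_mul' _ _ ENNReal.ofReal_ne_top, lintegral_inv_sq_add hy',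
        ← ENNReal.ofReal_mul (by positivity), ← ENNReal.ofReal_mul (by positivity),
        ← ENNReal.ofReal_mul (by positivity)]
      congr 1
      ring
    rw [setLIntegral_congr_fun measurableSet_Ioi h2,
      lintegral_const_mul' _ _ ENNReal.ofReal_ne_top, lintegral_inv_one_add_mul_inv_sqrt,
      ← ENNReal.ofReal_mul (by positivity)]
    congr 1
    ring
  · refine Measurable.aemeasurable ?_
    unfold Function.uncurry
    fun_prop

theorem integral_octant_inv_pairs :
    ∫ z in octant 2, ((1 + z 0) * (1 + z 1) * (z 0 + z 1))⁻¹ = Real.pi ^ 2 / 4 := by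
  rw [integral_eq_lintegral_of_nonneg_ae]
  · rw [volume_restrict_octant]
    have h := (measurePreserving_finTwoArrow (volume.restrict (Set.Ioi (0 : ℝ)))).lintegral_comp
      (f := fun p : ℝ × ℝ => ENNReal.ofReal ((1 + p.1) * (1 + p.2) * (p.1 + p.2))⁻¹) (by fun_prop)
    have h' := h.trans (lintegral_prod _ (by fun_prop))
    rw [lintegral_lintegral_inv_pairs] at h'
    refine (congrArg ENNReal.toReal h').trans (ENNReal.toReal_ofReal (by positivity))
  · refine (ae_restrict_iff' (measurableSet_octant 2)).2 (Eventually.of_forall fun z hz => ?_)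
    have h0 := mem_octant.1 hz 0
    have h1 := mem_octant.1 hz 1
    simp only [Pi.zero_apply]
    positivity
  · exact Measurable.aestronglyMeasurable (by fun_prop)

end

section

open MeasureTheory

/-- The real function `x / (exp x - 1)`. -/
noncomputable def expQuotient (x : ℝ) : ℝ := x / (Real.exp x - 1)

theorem measurable_expQuotient : Measurable expQuotient := by
  unfold expQuotient
  fun_prop

theorem expQuotient_nonneg {x : ℝ} (hx : 0 < x) : 0 ≤ expQuotient x :=
  mul_nonneg hx.le (inv_exp_sub_one_pos hx).le

theorem expQuotient_le {x : ℝ} (hx : 0 < x) : expQuotient x ≤ Real.exp (-x / 2) := by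
  have h := mul_exp_half_le_exp_sub_one hx.le
  rw [expQuotient, div_le_iff₀ (inv_pos.1 (inv_exp_sub_one_pos hx))]
  have h1 : Real.exp (-x / 2) * Real.exp (x / 2) = 1 := by
    rw [← Real.exp_add, neg_div, neg_add_cancel, Real.exp_zero]
  calc x = Real.exp (-x / 2) * (x * Real.exp (x / 2)) := by linear_combination (-x) * h1
    _ ≤ _ := mul_le_mul_of_nonneg_left h (Real.exp_nonneg _)

theorem expQuotient_le_one {x : ℝ} (hx : 0 < x) : expQuotient x ≤ 1 :=
  (expQuotient_le hx).trans (Real.exp_le_one_iff.2 (by linarith))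

theorem tendsto_expQuotient : Tendsto expQuotient (𝓝[>] 0) (𝓝 1) := by
  have h := (Real.hasDerivAt_exp 0).tendsto_slope_zero_right
  rw [Real.exp_zero] at h
  have h1 := h.inv₀ one_ne_zero
  rw [inv_one] at h1
  refine h1.congr fun x => ?_
  rw [zero_add, smul_eq_mul, expQuotient, mul_inv, inv_inv, div_eq_mul_inv]

theorem integral_octant_three {G : (Fin 3 → ℝ) → ℝ} (hG : IntegrableOn G (octant 3)) :
    ∫ t in octant 3, G t =
      ∫ u in Set.Ioi 0, u ^ 2 * ∫ z in octant 2, G ![u, u * z 0, u * z 1] := by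
  have hmp := (measurePreserving_piFinSuccAbove
    (fun _ : Fin 3 => (volume : Measure ℝ).restrict (Set.Ioi 0)) 0).symm
  rw [IntegrableOn, volume_restrict_octant] at hG
  have h1 := (hmp.integrable_comp_emb (MeasurableEquiv.measurableEmbedding _)).2 hG
  rw [volume_restrict_octant, ← hmp.integral_comp', 
    show ∫ p, G ((MeasurableEquiv.piFinSuccAbove (fun _ => ℝ) 0).symm p) ∂_ = _ from
      integral_prod _ h1]
  refine setIntegral_congr_fun measurableSet_Ioi fun u hu => ?_
  have hu' : 0 < u := hu
  have h2 := integral_octant_comp_mul (n := 2) (c := fun _ => u) (fun _ => hu')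
    fun y => G ![u, y 0, y 1]
  simp only [Pi.mul_apply] at h2
  simp only [h2, Fin.prod_univ_two, smul_eq_mul]
  rw [volume_restrict_octant, ← mul_assoc, ← sq, mul_inv_cancel₀ (by positivity), one_mul]
  refine integral_congr_ae (Eventually.of_forall fun y => ?_)
  simp only
  congr 1
  ext i
  fin_cases i <;> rfl

/-- The weight dominating the radial integrand. -/
noncomputable def radialWeight (x : ℝ) : ℝ := (1 + x) ^ (1 / 4 : ℝ) * (1 + x)⁻¹ * (√x)⁻¹

theorem integrableOn_radialWeight : IntegrableOn radialWeight (Set.Ioi 0) := by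
  have hm : Measurable radialWeight := by
    unfold radialWeight
    fun_prop
  have hle : ∀ x : ℝ, 0 < x → 0 ≤ radialWeight x := fun x hx => by
    unfold radialWeight
    positivity
  have heq : ∀ x : ℝ, 0 < x → radialWeight x = (1 + x) ^ (-3 / 4 : ℝ) * x ^ (-1 / 2 : ℝ) := by
    intro x hx
    rw [radialWeight, ← Real.rpow_neg_one, ← Real.rpow_add (by linarith), Real.sqrt_eq_rpow,
      ← Real.rpow_neg hx.le]
    norm_num
  rw [← Set.Ioo_union_Ici_eq_Ioi zero_lt_one]
  refine IntegrableOn.union ?_ ?_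
  · refine Integrable.mono' ((intervalIntegral.integrableOn_Ioo_rpow_iff one_pos).2
      (show (-1 : ℝ) < -1 / 2 by norm_num)) hm.aestronglyMeasurable
      ((ae_restrict_iff' measurableSet_Ioo).2 (Eventually.of_forall fun x hx => ?_))
    rw [Real.norm_of_nonneg (hle x hx.1), heq x hx.1]
    refine mul_le_of_le_one_left (Real.rpow_nonneg hx.1.le _) ?_
    exact Real.rpow_le_one_of_one_le_of_nonpos (by linarith [hx.1]) (by norm_num)
  · rw [integrableOn_Ici_iff_integrableOn_Ioi]
    refine Integrable.mono' (integrableOn_Ioi_rpow_of_lt (show (-5 / 4 : ℝ) < -1 by norm_num)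
      one_pos) hm.aestronglyMeasurable
      ((ae_restrict_iff' measurableSet_Ioi).2 (Eventually.of_forall fun x hx => ?_))
    have hx0 : 0 < x := one_pos.trans hx
    rw [Real.norm_of_nonneg (hle x hx0), heq x hx0, show (-5 / 4 : ℝ) = -3 / 4 + -1 / 2 by norm_num,
      Real.rpow_add hx0]
    refine mul_le_mul_of_nonneg_right ?_ (Real.rpow_nonneg hx0.le _)
    exact Real.rpow_le_rpow_of_nonpos hx0 (by linarith) (by norm_num)

/-- The integrand of the radial density of the Mellin integral of `pairBose` at `1 + ε`. -/
noncomputable def radialIntegrand (ε u : ℝ) (z : Fin 2 → ℝ) : ℝ :=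
  z 0 ^ ε * z 1 ^ ε * (expQuotient (u * (1 + z 0)) * expQuotient (u * (z 0 + z 1)) *
    expQuotient (u * (1 + z 1))) * ((1 + z 0) * (1 + z 1) * (z 0 + z 1))⁻¹

theorem measurable_radialIntegrand (ε : ℝ) :
    Measurable (Function.uncurry (radialIntegrand ε)) := by
  unfold radialIntegrand Function.uncurry
  have := measurable_expQuotient
  fun_prop

theorem norm_radialIntegrand_le {ε u : ℝ} (hε : 0 ≤ ε) (hε' : ε ≤ 1 / 4) (hu : 0 < u)
    {z : Fin 2 → ℝ} (hz : z ∈ octant 2) :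
    ‖radialIntegrand ε u z‖ ≤ Real.exp (-u / 2) * ∏ i, radialWeight (z i) := by
  have h0 := mem_octant.1 hz 0
  have h1 := mem_octant.1 hz 1
  have p0 : 0 < u * (1 + z 0) := by positivity
  have p1 : 0 < u * (z 0 + z 1) := by positivity
  have p2 : 0 < u * (1 + z 1) := by positivity
  have q0 := expQuotient_nonneg p0
  have q1 := expQuotient_nonneg p1
  have q2 := expQuotient_nonneg p2
  have hpow : ∀ x : ℝ, 0 < x → x ^ ε ≤ (1 + x) ^ (1 / 4 : ℝ) := fun x hx =>
    (Real.rpow_le_rpow hx.le (by linarith) hε).trans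
      (Real.rpow_le_rpow_of_exponent_le (by linarith) hε')
  have hexp : expQuotient (u * (1 + z 0)) ≤ Real.exp (-u / 2) :=
    (expQuotient_le p0).trans (Real.exp_le_exp.2 (by nlinarith))
  have hamgm : √(z 0) * √(z 1) ≤ z 0 + z 1 := by
    nlinarith [sq_nonneg (√(z 0) - √(z 1)), Real.sq_sqrt h0.le, Real.sq_sqrt h1.le,
      Real.sqrt_nonneg (z 0), Real.sqrt_nonneg (z 1)]
  have hinv : ((1 + z 0) * (1 + z 1) * (z 0 + z 1))⁻¹ ≤
      (1 + z 0)⁻¹ * (1 + z 1)⁻¹ * ((√(z 0))⁻¹ * (√(z 1))⁻¹) := by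
    rw [mul_inv, mul_inv, ← mul_inv (√(z 0))]
    exact mul_le_mul_of_nonneg_left (inv_anti₀ (by positivity) hamgm) (by positivity)
  have hψ : expQuotient (u * (1 + z 0)) * expQuotient (u * (z 0 + z 1)) *
      expQuotient (u * (1 + z 1)) ≤ Real.exp (-u / 2) * 1 * 1 := by
    gcongr
    · exact expQuotient_le_one p1
    · exact expQuotient_le_one p2
  unfold radialIntegrand
  rw [Real.norm_of_nonneg (by positivity), Fin.prod_univ_two, radialWeight, radialWeight]
  calc _ ≤ (1 + z 0) ^ (1 / 4 : ℝ) * (1 + z 1) ^ (1 / 4 : ℝ) * (Real.exp (-u / 2) * 1 * 1) *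
        ((1 + z 0)⁻¹ * (1 + z 1)⁻¹ * ((√(z 0))⁻¹ * (√(z 1))⁻¹)) := by
        gcongr ?_ * ?_ * ?_ * ?_
        · exact hpow _ h0
        · exact hpow _ h1
    _ = _ := by ring

/-- The radial density of the Mellin integral of `pairBose` at `1 + ε`. -/
noncomputable def radialDensity (ε u : ℝ) : ℝ := ∫ z in octant 2, radialIntegrand ε u z

theorem measurable_radialDensity (ε : ℝ) : Measurable (radialDensity ε) :=
  (StronglyMeasurable.integral_prod_right
    (measurable_radialIntegrand ε).stronglyMeasurable).measurable

theorem norm_radialDensity_le : ∃ M : ℝ, 0 ≤ M ∧ ∀ ε u : ℝ, 0 ≤ ε → ε ≤ 1 / 4 → 0 < u →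
    ‖radialDensity ε u‖ ≤ M * Real.exp (-u / 2) := by
  have hint := integrableOn_octant_prod (n := 2) fun _ => integrableOn_radialWeight
  refine ⟨∫ z in octant 2, ∏ i, radialWeight (z i), ?_, fun ε u hε hε' hu => ?_⟩
  · refine setIntegral_nonneg (measurableSet_octant 2) fun z hz => Finset.prod_nonneg fun i _ => ?_
    have := mem_octant.1 hz i
    unfold radialWeight
    positivity
  · refine (norm_integral_le_of_norm_le (hint.const_mul (Real.exp (-u / 2)))
      ((ae_restrict_iff' (measurableSet_octant 2)).2 (Eventually.of_forall fun z hz =>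
        norm_radialIntegrand_le hε hε' hu hz))).trans (le_of_eq ?_)
    rw [integral_const_mul, mul_comm]

theorem tendsto_radialDensity : Tendsto (Function.uncurry radialDensity)
    (𝓝[>] 0 ×ˢ 𝓝[>] 0) (𝓝 (Real.pi ^ 2 / 4)) := by
  rw [← integral_octant_inv_pairs]
  have hint := integrableOn_octant_prod (n := 2) fun _ => integrableOn_radialWeight
  have hε : ∀ᶠ p : ℝ × ℝ in 𝓝[>] 0 ×ˢ 𝓝[>] 0, 0 ≤ p.1 ∧ p.1 ≤ 1 / 4 ∧ 0 < p.2 := by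
    have h1 : ∀ᶠ ε : ℝ in 𝓝[>] 0, ε ≤ 1 / 4 :=
      (eventually_le_nhds (by norm_num)).filter_mono nhdsWithin_le_nhds
    have h2 : ∀ᶠ ε : ℝ in 𝓝[>] 0, 0 < ε := self_mem_nhdsWithin
    filter_upwards [(h1.and h2).prod_mk h2] with p hp
    exact ⟨hp.1.2.le, hp.1.1, hp.2⟩
  refine tendsto_integral_filter_of_dominated_convergence
    (fun z => ∏ i, radialWeight (z i)) ?_ ?_ hint ?_
  · exact Eventually.of_forall fun p =>
      ((measurable_radialIntegrand p.1).comp measurable_prodMk_left).aestronglyMeasurable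
  · filter_upwards [hε] with p hp
    refine (ae_restrict_iff' (measurableSet_octant 2)).2 (Eventually.of_forall fun z hz => ?_)
    refine (norm_radialIntegrand_le hp.1 hp.2.1 hp.2.2 hz).trans ?_
    refine mul_le_of_le_one_left (Finset.prod_nonneg fun i _ => ?_)
      (Real.exp_le_one_iff.2 (by linarith))
    have := mem_octant.1 hz i
    unfold radialWeight
    positivity
  · refine (ae_restrict_iff' (measurableSet_octant 2)).2 (Eventually.of_forall fun z hz => ?_)
    have h0 := mem_octant.1 hz 0
    have h1 := mem_octant.1 hz 1
    have hpow : ∀ x : ℝ, 0 < x →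
        Tendsto (fun p : ℝ × ℝ => x ^ p.1) (𝓝[>] 0 ×ˢ 𝓝[>] 0) (𝓝 1) := by
      intro x hx
      have h : Tendsto (fun ε : ℝ => x ^ ε) (𝓝 0) (𝓝 (x ^ (0 : ℝ))) :=
        (Real.continuousAt_const_rpow hx.ne').tendsto
      rw [Real.rpow_zero] at h
      exact (h.mono_left nhdsWithin_le_nhds).comp tendsto_fst
    have hψ : ∀ c : ℝ, 0 < c →
        Tendsto (fun p : ℝ × ℝ => expQuotient (p.2 * c)) (𝓝[>] 0 ×ˢ 𝓝[>] 0) (𝓝 1) := by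
      intro c hc
      refine tendsto_expQuotient.comp (tendsto_nhdsWithin_iff.2 ⟨?_, ?_⟩)
      · have h : Tendsto (fun u : ℝ => u * c) (𝓝 0) (𝓝 (0 * c)) :=
          Continuous.tendsto (by fun_prop) 0
        rw [zero_mul] at h
        exact (h.mono_left nhdsWithin_le_nhds).comp tendsto_snd
      · filter_upwards [hε] with p hp
        exact mul_pos hp.2.2 hc
    have h := (((hpow _ h0).mul (hpow _ h1)).mul (((hψ (1 + z 0) (by linarith)).mul
      (hψ (z 0 + z 1) (by linarith))).mul (hψ (1 + z 1) (by linarith)))).mul_const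
      ((1 + z 0) * (1 + z 1) * (z 0 + z 1))⁻¹
    rw [one_mul, one_mul, one_mul, one_mul] at h
    exact h

theorem mellinPi_pairBose_one_add {ε : ℝ} (hε : 0 < ε) :
    mellinPi pairBose (fun _ => 1 + (ε : ℂ)) =
      ((∫ u in Set.Ioi 0, u ^ (3 * ε - 1) * radialDensity ε u : ℝ) : ℂ) := by
  let G : (Fin 3 → ℝ) → ℝ := fun t => (∏ i, t i ^ ε) *
    ((Real.exp (t 0 + t 1) - 1)⁻¹ * (Real.exp (t 1 + t 2) - 1)⁻¹ * (Real.exp (t 2 + t 0) - 1)⁻¹)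
  have hker : ∀ t ∈ octant 3,
      mellinKernel (fun _ => 1 + (ε : ℂ)) t * pairBose t = ((G t : ℝ) : ℂ) := by
    intro t ht
    rw [pairBose_eq_ofReal, mellinKernel, Complex.ofReal_mul (∏ i, t i ^ ε), Complex.ofReal_prod]
    congr 1
    refine Finset.prod_congr rfl fun i _ => ?_
    rw [add_sub_cancel_left, Complex.ofReal_cpow (mem_octant.1 ht i).le]
  have hG : IntegrableOn G (octant 3) := by
    have h : MellinPiConvergent pairBose (fun _ => 1 + (ε : ℂ)) :=
      mellinPiConvergent_pairBose fun i => by simpa using hε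
    refine (h.congr_fun hker (measurableSet_octant 3)).re
  rw [mellinPi, setIntegral_congr_fun (measurableSet_octant 3) hker, integral_complex_ofReal,
    integral_octant_three hG]
  congr 1
  refine setIntegral_congr_fun measurableSet_Ioi fun u hu => ?_
  have hu' : 0 < u := hu
  simp only [radialDensity]
  rw [← integral_const_mul, ← integral_const_mul]
  refine setIntegral_congr_fun (measurableSet_octant 2) fun z hz => ?_
  have h0 := mem_octant.1 hz 0
  have h1 := mem_octant.1 hz 1
  have e : u ^ (3 * ε - 1) = u ^ ε * u ^ ε * u ^ ε * u⁻¹ := by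
    rw [← Real.rpow_add hu', ← Real.rpow_add hu', ← Real.rpow_neg_one u, ← Real.rpow_add hu']
    ring_nf
  simp only [G, Fin.prod_univ_three, Matrix.cons_val_zero, Matrix.cons_val_one, Matrix.cons_val,
    radialIntegrand, expQuotient, e]
  rw [Real.mul_rpow hu'.le h0.le, Real.mul_rpow hu'.le h1.le,
    show u + u * z 0 = u * (1 + z 0) by ring, show u * z 0 + u * z 1 = u * (z 0 + z 1) by ring,
    show u * z 1 + u = u * (1 + z 1) by ring]
  have h2 : 1 + z 0 ≠ 0 := by positivity
  have h3 : 1 + z 1 ≠ 0 := by positivity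
  have h4 : z 0 + z 1 ≠ 0 := by positivity
  simp only [div_eq_mul_inv, mul_inv]
  generalize (Real.exp (u * (1 + z 0)) - 1)⁻¹ = a
  generalize (Real.exp (u * (z 0 + z 1)) - 1)⁻¹ = b
  generalize (Real.exp (u * (1 + z 1)) - 1)⁻¹ = c
  field_simp

theorem tendsto_mul_integral_radialDensity :
    Tendsto (fun ε : ℝ => 3 * ε * ∫ u in Set.Ioi 0, u ^ (3 * ε - 1) * radialDensity ε u)
      (𝓝[>] 0) (𝓝 (Real.pi ^ 2 / 4)) := by
  obtain ⟨M, hM, hbound⟩ := norm_radialDensity_le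
  have hpos : ∀ᶠ ε : ℝ in 𝓝[>] 0, 0 < ε := self_mem_nhdsWithin
  have hle : ∀ᶠ ε : ℝ in 𝓝[>] 0, ε ≤ 1 / 4 :=
    (eventually_le_nhds (by norm_num)).filter_mono nhdsWithin_le_nhds
  have hinv : Tendsto (fun ε : ℝ => (3 * ε)⁻¹) (𝓝[>] 0) atTop := by
    refine tendsto_inv_nhdsGT_zero.comp (tendsto_nhdsWithin_iff.2 ⟨?_, ?_⟩)
    · have h : Tendsto (fun ε : ℝ => 3 * ε) (𝓝 0) (𝓝 (3 * 0)) := Continuous.tendsto (by fun_prop) 0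
      rw [mul_zero] at h
      exact h.mono_left nhdsWithin_le_nhds
    · filter_upwards [hpos] with ε h
      exact mul_pos three_pos h
  have hcov : ∀ᶠ ε : ℝ in 𝓝[>] 0, ∫ r in Set.Ioi 0, radialDensity ε (r ^ (3 * ε)⁻¹) =
      3 * ε * ∫ u in Set.Ioi 0, u ^ (3 * ε - 1) * radialDensity ε u := by
    filter_upwards [hpos] with ε h
    have h3 : 0 < 3 * ε := by positivity
    rw [← integral_comp_rpow_Ioi_of_pos h3, ← integral_const_mul]
    refine setIntegral_congr_fun measurableSet_Ioi fun u hu => ?_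
    have hu' : 0 < u := hu
    simp only [smul_eq_mul]
    rw [Real.rpow_rpow_inv hu'.le h3.ne']
    ring
  refine Tendsto.congr' hcov ?_
  have hlim : ∫ r in Set.Ioi (0 : ℝ), (Set.Iio 1).indicator (fun _ => Real.pi ^ 2 / 4) r =
      Real.pi ^ 2 / 4 := by
    rw [setIntegral_indicator measurableSet_Iio, Set.Ioi_inter_Iio, setIntegral_const]
    simp
  rw [← hlim]
  refine tendsto_integral_filter_of_dominated_convergence
    (fun r => M * Real.exp (1 / 2) * Real.exp (-1 / 2 * r)) ?_ ?_
    ((integrableOn_exp_mul_Ioi (by norm_num) 0).const_mul _) ?_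
  · exact Eventually.of_forall fun ε =>
      ((measurable_radialDensity ε).comp (by fun_prop)).aestronglyMeasurable
  · filter_upwards [hpos, hle] with ε h h'
    refine (ae_restrict_iff' measurableSet_Ioi).2 (Eventually.of_forall fun r hr => ?_)
    have hr' : 0 < r := hr
    refine (hbound ε _ h.le h' (Real.rpow_pos_of_pos hr' _)).trans ?_
    rw [mul_assoc, ← Real.exp_add]
    refine mul_le_mul_of_nonneg_left (Real.exp_le_exp.2 ?_) hM
    have h1 : r - 1 ≤ r ^ (3 * ε)⁻¹ := by
      rcases le_total r 1 with h2 | h2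
      · exact (sub_nonpos.2 h2).trans (Real.rpow_nonneg hr'.le _)
      · have h3 : r ^ (1 : ℝ) ≤ r ^ (3 * ε)⁻¹ := by
          refine Real.rpow_le_rpow_of_exponent_le h2 ?_
          rw [one_le_inv₀ (by positivity)]
          linarith
        rw [Real.rpow_one] at h3
        linarith
    linarith
  · refine (ae_restrict_iff' measurableSet_Ioi).2 ?_
    filter_upwards [Measure.ae_ne volume (1 : ℝ)] with r hr1 hr
    have hr' : 0 < r := hr
    rcases lt_or_gt_of_ne hr1 with h | h
    · rw [Set.indicator_of_mem (show r ∈ Set.Iio 1 from h)]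
      have h1 : Tendsto (fun ε : ℝ => r ^ (3 * ε)⁻¹) (𝓝[>] 0) (𝓝[>] 0) :=
        tendsto_nhdsWithin_iff.2 ⟨(tendsto_rpow_atTop_of_base_lt_one r (by linarith) h).comp hinv,
          Eventually.of_forall fun ε => Real.rpow_pos_of_pos hr' _⟩
      have h2 : Tendsto (fun ε : ℝ => (ε, r ^ (3 * ε)⁻¹)) (𝓝[>] 0) (𝓝[>] 0 ×ˢ 𝓝[>] 0) :=
        tendsto_id.prodMk h1
      have h3 := tendsto_radialDensity.comp h2
      simpa only [Function.comp_def, Function.uncurry_apply_pair] using h3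
    · rw [Set.indicator_of_notMem (show r ∉ Set.Iio 1 from not_lt.2 h.le)]
      have h1 : Tendsto (fun ε : ℝ => M * Real.exp (-(r ^ (3 * ε)⁻¹) / 2)) (𝓝[>] 0)
          (𝓝 (M * 0)) := by
        refine (Real.tendsto_exp_atBot.comp ?_).const_mul M
        have h2 := (tendsto_rpow_atTop_of_base_gt_one r h).comp hinv
        exact (tendsto_neg_atTop_atBot.comp h2).atBot_div_const two_pos
      rw [mul_zero] at h1
      refine squeeze_zero_norm' (a := fun ε : ℝ => M * Real.exp (-(r ^ (3 * ε)⁻¹) / 2)) ?_ h1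
      filter_upwards [hpos, hle] with ε h h'
      exact hbound ε _ h.le h' (Real.rpow_pos_of_pos hr' _)

theorem tendsto_mul_mellinPi_pairBose :
    Tendsto (fun ε : ℝ => 3 * (ε : ℂ) * mellinPi pairBose (fun _ => 1 + (ε : ℂ)))
      (𝓝[>] 0) (𝓝 ((Real.pi : ℂ) ^ 2 / 4)) := by
  have h := (Complex.continuous_ofReal.tendsto _).comp tendsto_mul_integral_radialDensity
  push_cast at h
  refine h.congr' ?_
  filter_upwards [self_mem_nhdsWithin] with ε hε
  rw [mellinPi_pairBose_one_add hε, Function.comp_apply]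
  push_cast
  rfl

end

section

open MeasureTheory

/-- The normalized Mellin transform of `pairBose`, which sums the symmetric zeta series. -/
noncomputable def symZetaSum (s : Fin 3 → ℂ) : ℂ :=
  mellinPi pairBose s * ∏ i, (Complex.Gamma (s i))⁻¹

theorem hasSum_symZetaTerm_symZetaSum {s : Fin 3 → ℂ} (hs : ∀ i, 1 < (s i).re) :
    HasSum (symZetaTerm s) (symZetaSum s) := by
  have hΓ : ∏ i, Complex.Gamma (s i) ≠ 0 := Finset.prod_ne_zero_iff.2 fun i _ =>
    Complex.Gamma_ne_zero_of_re_pos (one_pos.trans (hs i))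
  have h := (hasSum_symZetaTerm hs).mul_right (∏ i, Complex.Gamma (s i))⁻¹
  rw [← Finset.prod_inv_distrib] at h
  refine h.congr_fun fun n => ?_
  rw [Finset.prod_inv_distrib]
  field_simp

/-- The half-space product `Re sᵢ > -K`. -/
def rightDomain (K : ℕ) : Set (Fin 3 → ℂ) := {s | ∀ i, -(K : ℝ) < (s i).re}

theorem isOpen_forall_lt_re (a : ℝ) : IsOpen {s : Fin 3 → ℂ | ∀ i, a < (s i).re} := by
  simp only [Set.ofPred_forall]
  exact isOpen_iInter_of_finite fun i => isOpen_lt continuous_const (by fun_prop)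

theorem convex_rightDomain (K : ℕ) : Convex ℝ (rightDomain K) := by
  have h : rightDomain K = Set.univ.pi fun _ => {z : ℂ | -(K : ℝ) < z.re} := by
    ext s
    simp [rightDomain]
  rw [h]
  exact convex_pi fun i _ => convex_halfSpace_re_gt _

theorem mem_rightDomain_of_one_lt {s : Fin 3 → ℂ} (hs : ∀ i, 1 < (s i).re) (K : ℕ) :
    s ∈ rightDomain K := fun i => by
  have := hs i
  have : (0 : ℝ) ≤ K := K.cast_nonneg
  linarith

/-- The numerator of the continuation to `rightDomain K`. -/
noncomputable def symZetaNum (K : ℕ) (s : Fin 3 → ℂ) : ℂ :=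
  mellinPi (dilate (fullPoly (3 * K + 3)) pairBose) s * ∏ i, (Complex.Gamma (s i))⁻¹

/-- The denominator of the continuation to `rightDomain K`. -/
noncomputable def symZetaDen (K : ℕ) (s : Fin 3 → ℂ) : ℂ :=
  MvPolynomial.eval (fun i => (2 : ℂ) ^ (-s i)) (fullPoly (3 * K + 3))

theorem analyticAt_apply {n : ℕ} (i : Fin n) (s : Fin n → ℂ) :
    AnalyticAt ℂ (fun s : Fin n → ℂ => s i) s :=
  (ContinuousLinearMap.proj (R := ℂ) (φ := fun _ : Fin n => ℂ) i).analyticAt s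

theorem analyticOnNhd_symZetaNum (K : ℕ) : AnalyticOnNhd ℂ (symZetaNum K) (rightDomain K) := by
  obtain ⟨C, ε, hε, h⟩ := norm_dilate_fullPoly_le K
  refine (analyticOnNhd_mellinPi (measurable_dilate measurable_pairBose _).aestronglyMeasurable
    hε h).mul (Finset.analyticOnNhd_fun_prod _ fun i _ s _ => ?_)
  exact (Complex.differentiable_one_div_Gamma.analyticAt (s i)).comp
    (f := fun s : Fin 3 → ℂ => s i) (analyticAt_apply i s)

theorem symZetaNum_eq {s : Fin 3 → ℂ} (hs : ∀ i, 1 < (s i).re) (K : ℕ) :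
    symZetaNum K s = symZetaDen K s * symZetaSum s := by
  rw [symZetaNum, mellinPi_dilate _ (mellinPiConvergent_pairBose hs), symZetaDen, symZetaSum,
    mul_assoc]

theorem eval_fullPoly (N : ℕ) (x : Fin 3 → ℂ) : MvPolynomial.eval x (fullPoly N) =
    ∏ I : Finset (Fin 3) with I.Nonempty,
      ∏ k ∈ Finset.range N, (∏ i ∈ I, x i - 2 ^ k / 2 ^ I.card.choose 2) := by
  simp only [fullPoly, map_prod, eval_stepPoly]

theorem analyticAt_two_cpow_neg (i : Fin 3) (s : Fin 3 → ℂ) :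
    AnalyticAt ℂ (fun s : Fin 3 → ℂ => (2 : ℂ) ^ (-s i)) s := by
  have h : Differentiable ℂ fun z : ℂ => (2 : ℂ) ^ (-z) := by
    intro z
    exact (differentiableAt_id.neg).const_cpow (Or.inl two_ne_zero)
  exact (h.analyticAt (s i)).comp (f := fun s : Fin 3 → ℂ => s i)
    (analyticAt_apply i s)

theorem analyticAt_symZetaDen (K : ℕ) (s : Fin 3 → ℂ) : AnalyticAt ℂ (symZetaDen K) s := by
  have h : symZetaDen K = fun s => ∏ I : Finset (Fin 3) with I.Nonempty,
      ∏ k ∈ Finset.range (3 * K + 3),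
        (∏ i ∈ I, (2 : ℂ) ^ (-s i) - 2 ^ k / 2 ^ I.card.choose 2) :=
    funext fun s => eval_fullPoly _ _
  rw [h]
  refine Finset.analyticAt_fun_prod _ fun I _ => Finset.analyticAt_fun_prod _ fun k _ => ?_
  exact (Finset.analyticAt_fun_prod _ fun i _ => analyticAt_two_cpow_neg i s).sub analyticAt_const

theorem prod_sub_two_pow_div_ne_zero {ι : Type*} {I : Finset ι} {x : ι → ℂ} {d k : ℕ}
    (h : ∏ i ∈ I, ‖x i‖ < (2 ^ d)⁻¹) : ∏ i ∈ I, x i - 2 ^ k / 2 ^ d ≠ 0 := by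
  intro h0
  have h1 := congrArg norm (sub_eq_zero.1 h0)
  rw [norm_prod, norm_div, norm_pow, norm_pow, Complex.norm_ofNat] at h1
  rw [h1, div_eq_mul_inv] at h
  have h2 : (1 : ℝ) ≤ 2 ^ k := one_le_pow₀ one_le_two
  have h3 : (0 : ℝ) < (2 ^ d)⁻¹ := by positivity
  nlinarith

theorem norm_two_cpow_neg (z : ℂ) : ‖(2 : ℂ) ^ (-z)‖ = 2 ^ (-z.re) := by
  have := Complex.norm_cpow_eq_rpow_re_of_pos two_pos (-z)
  simpa using this

theorem choose_two_le_card (I : Finset (Fin 3)) : I.card.choose 2 ≤ I.card := by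
  have h : I.card ≤ 3 := by simpa using I.card_le_univ
  interval_cases I.card <;> decide

theorem symZetaDen_ne_zero {s : Fin 3 → ℂ} (hs : ∀ i, 1 < (s i).re) (K : ℕ) :
    symZetaDen K s ≠ 0 := by
  rw [symZetaDen, eval_fullPoly]
  refine Finset.prod_ne_zero_iff.2 fun I hI => Finset.prod_ne_zero_iff.2 fun k _ =>
    prod_sub_two_pow_div_ne_zero ?_
  have hlt : ∀ i, ‖(2 : ℂ) ^ (-s i)‖ < 2⁻¹ := fun i => by
    rw [norm_two_cpow_neg, ← Real.rpow_neg_one]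
    exact Real.rpow_lt_rpow_of_exponent_lt one_lt_two (neg_lt_neg (hs i))
  calc ∏ i ∈ I, ‖(2 : ℂ) ^ (-s i)‖ < ∏ _i ∈ I, (2⁻¹ : ℝ) :=
        Finset.prod_lt_prod_of_nonempty (fun i _ => norm_pos_iff.2 (by simp)) (fun i _ => hlt i)
          (Finset.mem_filter.1 hI).2
    _ = (2 ^ I.card)⁻¹ := by rw [Finset.prod_const, inv_pow]
    _ ≤ _ := inv_anti₀ (by positivity) (pow_le_pow_right₀ one_le_two (choose_two_le_card I))

theorem eventually_forall_one_lt_re {p : Fin 3 → ℂ} (hp : ∀ i, 1 < (p i).re) :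
    ∀ᶠ s in 𝓝 p, ∀ i, 1 < (s i).re := (isOpen_forall_lt_re 1).mem_nhds hp

theorem not_eventually_symZetaDen_eq_zero (K : ℕ) (p : Fin 3 → ℂ) :
    ¬ ∀ᶠ z in 𝓝 p, symZetaDen K z = 0 := by
  intro h
  have h1 := AnalyticOnNhd.eqOn_of_preconnected_of_eventuallyEq (U := Set.univ)
    (fun s _ => analyticAt_symZetaDen K s) analyticOnNhd_const isPreconnected_univ
    (Set.mem_univ p) h
  exact symZetaDen_ne_zero (s := fun _ => 2) (by simp) K (h1 (Set.mem_univ _))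

theorem symZetaNum_mul_symZetaDen (K L : ℕ) {z : Fin 3 → ℂ}
    (hz : z ∈ rightDomain K ∩ rightDomain L) :
    symZetaNum K z * symZetaDen L z = symZetaNum L z * symZetaDen K z := by
  have h2 : ∀ i : Fin 3, 1 < ((fun _ => 2 : Fin 3 → ℂ) i).re := by simp
  refine AnalyticOnNhd.eqOn_of_preconnected_of_eventuallyEq (z₀ := fun _ => 2)
    (((analyticOnNhd_symZetaNum K).mono Set.inter_subset_left).mul
      fun s _ => analyticAt_symZetaDen L s)
    (((analyticOnNhd_symZetaNum L).mono Set.inter_subset_right).mul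
      fun s _ => analyticAt_symZetaDen K s)
    ((convex_rightDomain K).inter (convex_rightDomain L)).isPreconnected
    ⟨mem_rightDomain_of_one_lt h2 K, mem_rightDomain_of_one_lt h2 L⟩ ?_ hz
  filter_upwards [eventually_forall_one_lt_re h2] with s hs
  rw [symZetaNum_eq hs, symZetaNum_eq hs]
  ring

theorem exists_isSymmetricZeta : ∃ ζS : (Fin 3 → ℂ) → ℂ, IsSymmetricZeta ζS := by
  have hcover : ∀ p, ∃ k, p ∈ rightDomain k := by
    intro p
    obtain ⟨k, hk⟩ := exists_nat_gt (∑ i, |(p i).re|)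
    refine ⟨k, fun i => ?_⟩
    have h1 : |(p i).re| ≤ ∑ i, |(p i).re| :=
      Finset.single_le_sum (f := fun i => |(p i).re|) (fun _ _ => abs_nonneg _) (Finset.mem_univ i)
    linarith [neg_abs_le (p i).re]
  obtain ⟨F, hF, hF'⟩ := exists_isMeromorphicFunction_of_exhaustion (Ω := rightDomain)
    (P := symZetaNum) (Q := symZetaDen) (fun k => isOpen_forall_lt_re _) hcover
    analyticOnNhd_symZetaNum (fun k s _ => analyticAt_symZetaDen k s)
    (fun k p _ => not_eventually_symZetaDen_eq_zero k p)
    (fun k l z hz => symZetaNum_mul_symZetaDen k l hz)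
  refine ⟨F, hF, fun s hs => ?_⟩
  have h0 := symZetaDen_ne_zero hs 0
  rw [hF' 0 s (mem_rightDomain_of_one_lt hs 0) h0, symZetaNum_eq hs, mul_div_cancel_left₀ _ h0]
  exact hasSum_symZetaTerm_symZetaSum hs

theorem IsSymmetricZeta.eventually_eq_div {ζS : (Fin 3 → ℂ) → ℂ} (h : IsSymmetricZeta ζS) :
    ∀ᶠ s in 𝓝 (fun _ => 1), symZetaDen 0 s ≠ 0 → ζS s = symZetaNum 0 s / symZetaDen 0 s := by
  refine h.meromorphic.eventually_eq_div (isOpen_forall_lt_re 1) ?_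
    (analyticOnNhd_symZetaNum 0 _ fun i => by simp) (analyticAt_symZetaDen 0 _) fun s hs => ?_
  · have h1 : Tendsto (fun ε : ℝ => fun _ : Fin 3 => 1 + (ε : ℂ)) (𝓝[>] 0) (𝓝 fun _ => 1) := by
      have : Tendsto (fun ε : ℝ => fun _ : Fin 3 => 1 + (ε : ℂ)) (𝓝 0)
        (𝓝 fun _ => 1 + ((0 : ℝ) : ℂ)) := Continuous.tendsto (by fun_prop) 0
      rw [Complex.ofReal_zero, add_zero] at this
      exact this.mono_left nhdsWithin_le_nhds
    refine mem_closure_of_tendsto h1 ?_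
    filter_upwards [self_mem_nhdsWithin] with ε hε i
    simpa using hε
  · refine ⟨symZetaDen_ne_zero hs 0, ?_⟩
    rw [symZetaNum_eq hs, mul_div_cancel_left₀ _ (symZetaDen_ne_zero hs 0)]
    exact (h.hasSum s hs).unique (hasSum_symZetaTerm_symZetaSum hs)

/-- Near `(1, 1, 1)` the denominator `symZetaDen 0` vanishes to first order along
`s 0 + s 1 + s 2 = 3` and nowhere else. -/
theorem exists_symZetaDen_eq_mul : ∃ B : (Fin 3 → ℂ) → ℂ, ContinuousAt B (fun _ => 1) ∧
    B (fun _ => 1) ≠ 0 ∧ ∀ s, symZetaDen 0 s = (s 0 + s 1 + s 2 - 3) * B s := by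
  let g : ℂ → ℂ := fun z => 2 ^ (-z)
  have hlog : Complex.log 2 ≠ 0 := by
    rw [← Complex.ofReal_ofNat, ← Complex.ofReal_log two_pos.le]
    exact_mod_cast (Real.log_pos one_lt_two).ne'
  have hg : ∀ z, HasDerivAt g (-(2 ^ (-z) * Complex.log 2)) z := fun z => by
    have := (hasDerivAt_id z).neg.const_cpow (c := 2) (Or.inl two_ne_zero)
    simpa using this
  let R : Finset (Fin 3) → (Fin 3 → ℂ) → ℂ := fun I s =>
    ∏ k ∈ Finset.range 3, (∏ i ∈ I, (2 : ℂ) ^ (-s i) - 2 ^ k / 2 ^ I.card.choose 2)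
  let T : (Fin 3 → ℂ) → ℂ := fun s =>
    ∏ k ∈ Finset.range 2, (∏ i, (2 : ℂ) ^ (-s i) - 2 ^ (k + 1) / 2 ^ 3)
  let S : Finset (Finset (Fin 3)) := (Finset.univ.filter Finset.Nonempty).erase Finset.univ
  have hcont : ∀ i, ContinuousAt (fun s : Fin 3 → ℂ => (2 : ℂ) ^ (-s i)) (fun _ => 1) :=
    fun i => (analyticAt_two_cpow_neg i _).continuousAt
  refine ⟨fun s => dslope g 3 (s 0 + s 1 + s 2) * (T s * ∏ I ∈ S, R I s), ?_, ?_, fun s => ?_⟩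
  · refine ContinuousAt.mul ?_ (ContinuousAt.mul ?_ ?_)
    · have := (hg 3).differentiableAt
      refine ContinuousAt.comp (g := dslope g 3) ?_ (by fun_prop)
      norm_num [this]
    · exact tendsto_finsetProd _ fun k _ =>
        (tendsto_finsetProd _ fun i _ => hcont i).sub tendsto_const_nhds
    · exact tendsto_finsetProd _ fun I _ => tendsto_finsetProd _ fun k _ =>
        (tendsto_finsetProd _ fun i _ => hcont i).sub tendsto_const_nhds
  · refine mul_ne_zero ?_ (mul_ne_zero ?_ ?_)
    · norm_num
      rw [(hg 3).deriv]
      simpa using hlog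
    · simp only [T, Finset.prod_range_succ, Finset.prod_range_zero, Finset.prod_const,
        Finset.card_univ, Fintype.card_fin, Complex.cpow_neg_one]
      norm_num
    · refine Finset.prod_ne_zero_iff.2 fun I hI => Finset.prod_ne_zero_iff.2 fun k _ =>
        prod_sub_two_pow_div_ne_zero ?_
      have hI1 : I ≠ Finset.univ := (Finset.mem_erase.1 hI).1
      have hI2 : I.card ≠ 0 :=
        Finset.card_ne_zero.2 (Finset.mem_filter.1 (Finset.mem_erase.1 hI).2).2
      have hI3 : I.card < 3 := by
        simpa using Finset.card_lt_card (Finset.ssubset_univ_iff.2 hI1)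
      have hlt : I.card.choose 2 < I.card := by interval_cases I.card <;> first | omega | decide
      simp only [Complex.cpow_neg_one, norm_inv, Complex.norm_ofNat, Finset.prod_const]
      rw [inv_pow]
      exact inv_strictAnti₀ (by positivity) (pow_lt_pow_right₀ one_lt_two hlt)
  · have hprod : ∏ i, (2 : ℂ) ^ (-s i) = g (s 0 + s 1 + s 2) := by
      simp only [g, Fin.prod_univ_three, ← Complex.cpow_add _ _ (two_ne_zero' ℂ)]
      congr 1
      ring
    have huniv : R Finset.univ s =
        (g (s 0 + s 1 + s 2) - g 3) * T s := by
      have h3 : g 3 = 2 ^ 0 / 2 ^ 3 := by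
        simp only [g]
        rw [Complex.cpow_neg, show (3 : ℂ) = ((3 : ℕ) : ℂ) by norm_num, Complex.cpow_natCast]
        norm_num
      simp only [R, T]
      rw [Finset.prod_range_succ', h3, hprod, mul_comm]
      rfl
    have hmem : (Finset.univ : Finset (Fin 3)) ∈ Finset.univ.filter Finset.Nonempty := by simp
    have hsub := sub_smul_dslope g 3 (s 0 + s 1 + s 2)
    rw [smul_eq_mul] at hsub
    rw [symZetaDen, eval_fullPoly, ← Finset.mul_prod_erase _ _ hmem]
    change R Finset.univ s * ∏ I ∈ S, R I s = _
    rw [huniv, ← hsub]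
    ring

theorem tendsto_mul_symZetaSum :
    Tendsto (fun ε : ℝ => 3 * (ε : ℂ) * symZetaSum (fun _ => 1 + (ε : ℂ)))
      (𝓝[>] 0) (𝓝 ((Real.pi : ℂ) ^ 2 / 4)) := by
  have h1 : Tendsto (fun ε : ℝ => ∏ _i : Fin 3, (Complex.Gamma (1 + (ε : ℂ)))⁻¹) (𝓝[>] 0)
      (𝓝 1) := by
    have h : ContinuousAt (fun ε : ℝ => ∏ _i : Fin 3, (Complex.Gamma (1 + (ε : ℂ)))⁻¹) 0 := by
      have h2 : Continuous fun z : ℂ => (Complex.Gamma z)⁻¹ :=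
        Complex.differentiable_one_div_Gamma.continuous
      refine tendsto_finsetProd _ fun i _ => ?_
      exact (h2.comp (by fun_prop : Continuous fun ε : ℝ => 1 + (ε : ℂ))).tendsto 0
    have h3 := h.tendsto
    simp only [Complex.ofReal_zero, add_zero, Complex.Gamma_one, inv_one,
      Finset.prod_const_one] at h3
    exact h3.mono_left nhdsWithin_le_nhds
  have h2 := tendsto_mul_mellinPi_pairBose.mul h1
  rw [mul_one] at h2
  refine h2.congr fun ε => ?_
  rw [symZetaSum, mul_assoc]

theorem tendsto_mul_isSymmetricZeta {ζS : (Fin 3 → ℂ) → ℂ} (h : IsSymmetricZeta ζS) :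
    Tendsto (fun s : Fin 3 → ℂ => (s 0 + s 1 + s 2 - 3) * ζS s)
      (𝓝[{s : Fin 3 → ℂ | s 0 + s 1 + s 2 ≠ 3}] (fun _ => 1)) (𝓝 ((Real.pi : ℂ) ^ 2 / 4)) := by
  obtain ⟨B, hBc, hB0, hB⟩ := exists_symZetaDen_eq_mul
  have hH : ContinuousAt (fun s => symZetaNum 0 s / B s) (fun _ => 1) :=
    (analyticOnNhd_symZetaNum 0 _ fun i => by simp).continuousAt.div hBc hB0
  have heq : ∀ᶠ s in 𝓝[{s : Fin 3 → ℂ | s 0 + s 1 + s 2 ≠ 3}] (fun _ => 1),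
      symZetaNum 0 s / B s = (s 0 + s 1 + s 2 - 3) * ζS s := by
    filter_upwards [h.eventually_eq_div.filter_mono nhdsWithin_le_nhds,
      (hBc.eventually_ne hB0).filter_mono nhdsWithin_le_nhds, self_mem_nhdsWithin] with s h1 h2 h3
    have h4 : s 0 + s 1 + s 2 - 3 ≠ 0 := sub_ne_zero.2 h3
    rw [hB] at h1
    rw [h1 (mul_ne_zero h4 h2)]
    field_simp
  have hlim : Tendsto (fun s : Fin 3 → ℂ => (s 0 + s 1 + s 2 - 3) * ζS s)
      (𝓝[{s : Fin 3 → ℂ | s 0 + s 1 + s 2 ≠ 3}] (fun _ => 1))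
      (𝓝 (symZetaNum 0 (fun _ => 1) / B fun _ => 1)) :=
    (hH.tendsto.mono_left nhdsWithin_le_nhds).congr' heq
  have hdiag : Tendsto (fun ε : ℝ => fun _ : Fin 3 => 1 + (ε : ℂ)) (𝓝[>] 0)
      (𝓝[{s : Fin 3 → ℂ | s 0 + s 1 + s 2 ≠ 3}] fun _ => 1) := by
    refine tendsto_nhdsWithin_iff.2 ⟨?_, ?_⟩
    · have : Tendsto (fun ε : ℝ => fun _ : Fin 3 => 1 + (ε : ℂ)) (𝓝 0)
        (𝓝 fun _ => 1 + ((0 : ℝ) : ℂ)) := Continuous.tendsto (by fun_prop) 0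
      rw [Complex.ofReal_zero, add_zero] at this
      exact this.mono_left nhdsWithin_le_nhds
    · filter_upwards [self_mem_nhdsWithin] with ε hε h0
      have h1 : (3 : ℂ) * ε = 0 := by linear_combination h0
      exact (ne_of_gt hε) (by simpa using h1)
  have h1 := hlim.comp hdiag
  have h2 := tendsto_nhds_unique h1 (tendsto_mul_symZetaSum.congr' ?_)
  · rwa [← h2]
  · filter_upwards [self_mem_nhdsWithin] with ε hε
    have hs : ∀ i : Fin 3, 1 < ((fun _ => 1 + (ε : ℂ) : Fin 3 → ℂ) i).re := fun _ => by
      simpa using hε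
    rw [Function.comp_apply, (h.hasSum _ hs).unique (hasSum_symZetaTerm_symZetaSum hs)]
    ring

end

/-- The symmetric zeta function exists as a meromorphic function on `ℂ³`, and its product with
`s₁ + s₂ + s₃ - 3` tends to `π² / 4` as `s → (1, 1, 1)` off the polar hyperplane
`s₁ + s₂ + s₃ = 3`. -/
theorem theorem1p2 :
    (∃ ζS : (Fin 3 → ℂ) → ℂ, IsSymmetricZeta ζS) ∧
    ∀ ζS : (Fin 3 → ℂ) → ℂ, IsSymmetricZeta ζS →
      Tendsto (fun s : Fin 3 → ℂ => (s 0 + s 1 + s 2 - 3) * ζS s)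
        (𝓝[{s : Fin 3 → ℂ | s 0 + s 1 + s 2 ≠ 3}] (fun _ => 1))
        (𝓝 ((Real.pi : ℂ) ^ 2 / 4)) :=
  ⟨exists_isSymmetricZeta, fun _ h => tendsto_mul_isSymmetricZeta h⟩
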